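/- All graphs are finite and simple. A graph is *nice* if it has no connected component isomorphic to $K_2$. For an orientation $D$ of a graph $G$, let $$P_D=\prod_{(u,v)\in E(D)}(X_v-X_u),\qquad X_v=\sum_{e\ni v}x_e,$$ a real polynomial with one variable $x_e$ for each edge $e$ of $G$. The monomial index $\mathrm{mind}(G)$ is the minimum, over all monomials $M$ occurring in $P_D$ with nonzero coefficient, of the largest exponent of a variable in $M$ (and $\infty$ if $P_D=0$); it does not depend on $D$, because changing the orientation only changes the sign of $P_D$. The edge weight choosability number $\mathrm{ch}^e_\Sigma(G)$ is the smallest $k$ (or $\infty$ if there is none) such that, for every assignment to the edges $e$ of $G$ of lists $L_e$ of $k$ real numbers, one can choose weights $w(e)\in L_e$ for which $\sum_{e\ni u}w(e)\neq\sum_{e\ni v}w(e)$ for all adjacent vertices $u,v$. The $2$-degeneracy is $\partial_2(G)=\max_H\delta_2(H)$, where $H$ runs over the induced subgraphs of $G$ that have two vertices at distance exactly $2$ in $H$, and $\delta_2(H)$ is the minimum of $d_H(u)+d_H(v)$ over pairs of vertices $u,v$ at distance exactly $2$ in $H$. If there is no such $H$, then $\partial_2(G)=2\Delta(G)$, where $\Delta(G)$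 is the maximum degree of $G$. **Theorem.** If $G$ is a nice graph on at least $3$ vertices, then $\mathrm{mind}(G)\le\partial_2(G)$, and hence $\mathrm{ch}^e_\Sigma(G)\le\partial_2(G)+1$. -/

import Mathlib

noncomputable section

namespace SimpleGraph

open Classical in
/-- The sum `∑_{e ∋ v} w(e)` of the weights of the edges incident with the vertex `v`. -/
def incidentSum {V : Type*} [Fintype V] (G : SimpleGraph V) {R : Type*} [AddCommMonoid R]
    (w : G.edgeSet → R) (v : V) : R :=
  ∑ e ∈ Finset.univ.filter (fun e : G.edgeSet => v ∈ (e : Sym2 V)), w e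

/-- The edge weighting `w` is a vertex colouring by sums: adjacent vertices have different
sums of incident edge weights. -/
def IsVertexColouringBySums {V : Type*} [Fintype V] (G : SimpleGraph V)
    (w : G.edgeSet → ℝ) : Prop :=
  ∀ u v : V, G.Adj u v → G.incidentSum w u ≠ G.incidentSum w v

/-- Every assignment of lists of `k` real numbers to the edges of `G` permits an edge
list-weighting which is a vertex colouring by sums. -/
def EdgeWeightChoosable {V : Type*} [Fintype V] (G : SimpleGraph V) (k : ℕ) : Prop :=
  ∀ L : G.edgeSet → Finset ℝ, (∀ e, (L e).card = k) →
    ∃ w : G.edgeSet → ℝ, (∀ e, w e ∈ L e) ∧ G.IsVertexColouringBySums w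

/-- The edge weight choosability number: the smallest `k` such that `G` is edge weight
`k`-choosable, and `⊤` if there is no such `k`. -/
def edgeWeightChoosabilityNumber {V : Type*} [Fintype V] (G : SimpleGraph V) : ℕ∞ :=
  ⨅ (k : ℕ) (_ : G.EdgeWeightChoosable k), (k : ℕ∞)

/-- A graph is nice if it has no connected component isomorphic to `K₂`. -/
def IsNice {V : Type*} (G : SimpleGraph V) : Prop :=
  ∀ C : G.ConnectedComponent, IsEmpty (G.induce C.supp ≃g completeGraph (Fin 2))

/-- An orientation of `G`: every edge is given a tail and a head, which are its two ends. -/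
structure EdgeOrientation {V : Type*} (G : SimpleGraph V) where
  /-- the initial vertex of the edge -/
  tail : G.edgeSet → V
  /-- the terminal vertex of the edge -/
  head : G.edgeSet → V
  ends_eq : ∀ e : G.edgeSet, s(tail e, head e) = (e : Sym2 V)

instance {V : Type*} (G : SimpleGraph V) : Nonempty G.EdgeOrientation :=
  ⟨{ tail := fun e => (Quot.out (e : Sym2 V)).1
     head := fun e => (Quot.out (e : Sym2 V)).2
     ends_eq := fun e => Quot.out_eq (e : Sym2 V) }⟩

/-- The polynomial `P_D = ∏_{(u,v) ∈ E(D)} (X_v - X_u)`, with one variable `x_e` for each edge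
`e`, where `X_v = ∑_{e ∋ v} x_e`. -/
def EdgeOrientation.colouringPolynomial {V : Type*} [Fintype V] {G : SimpleGraph V}
    (D : G.EdgeOrientation) : MvPolynomial G.edgeSet ℝ :=
  open Classical in
  ∏ e : G.edgeSet,
    (G.incidentSum (MvPolynomial.X : G.edgeSet → MvPolynomial G.edgeSet ℝ) (D.head e)
      - G.incidentSum (MvPolynomial.X : G.edgeSet → MvPolynomial G.edgeSet ℝ) (D.tail e))

end SimpleGraph

/-- The monomial index of `P`: the minimum, over all monomials `M` occurring in `P` with nonzero
coefficient, of the largest exponent of a variable in `M`. It is `⊤` for the zero polynomial. -/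
def MvPolynomial.monomialIndex {σ R : Type*} [CommSemiring R] (P : MvPolynomial σ R) : ℕ∞ :=
  ⨅ M ∈ P.support, ((M.support.sup M : ℕ) : ℕ∞)

namespace SimpleGraph

/-- The monomial index `mind(G)` of a graph: the monomial index of `P_D`, where `D` is an
orientation of `G`; by `monomialIndex_eq` below, the choice of `D` does not matter. -/
def monomialIndex {V : Type*} [Fintype V] (G : SimpleGraph V) : ℕ∞ :=
  (Classical.arbitrary G.EdgeOrientation).colouringPolynomial.monomialIndex

theorem EdgeOrientation.colouringPolynomial_eq_or_eq_neg {V : Type*} [Fintype V]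
    {G : SimpleGraph V} (D D' : G.EdgeOrientation) :
    D.colouringPolynomial = D'.colouringPolynomial ∨
      D.colouringPolynomial = -D'.colouringPolynomial := by
  classical
  unfold EdgeOrientation.colouringPolynomial
  refine Finset.induction_on (Finset.univ : Finset G.edgeSet) (Or.inl (by simp)) ?_
  intro e s he ih
  rw [Finset.prod_insert he, Finset.prod_insert he]
  have h := (D.ends_eq e).trans (D'.ends_eq e).symm
  rw [Sym2.eq_iff] at h
  rcases h with ⟨h1, h2⟩ | ⟨h1, h2⟩ <;> rcases ih with ih | ih <;> rw [h1, h2, ih]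
  · exact Or.inl rfl
  · exact Or.inr (by ring)
  · exact Or.inr (by ring)
  · exact Or.inl (by ring)

theorem monomialIndex_eq {V : Type*} [Fintype V] (G : SimpleGraph V) (D : G.EdgeOrientation) :
    G.monomialIndex = D.colouringPolynomial.monomialIndex := by
  unfold SimpleGraph.monomialIndex MvPolynomial.monomialIndex
  rcases (Classical.arbitrary G.EdgeOrientation).colouringPolynomial_eq_or_eq_neg D with h | h <;>
    simp [h]

/-- There are two vertices at distance exactly `t` in `G`. -/
def HasPairAtDist {V : Type*} (G : SimpleGraph V) (t : ℕ) : Prop :=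
  ∃ u v : V, G.edist u v = t

open Classical in
/-- `δ_t(G)`: the minimum of `d(u) + d(v)` over the pairs of vertices `u, v` at distance exactly
`t` in `G` (used only if there is such a pair). -/
def minDegreeSumAtDist {V : Type*} [Fintype V] (G : SimpleGraph V) (t : ℕ) : ℕ :=
  sInf {n : ℕ | ∃ u v : V, G.edist u v = t ∧ n = G.degree u + G.degree v}

open Classical in
/-- The `t`-degeneracy `∂_t(G)`: the maximum of `δ_t(H)` over the induced subgraphs `H` of `G`
that have two vertices at distance exactly `t` in `H`; if there is no such `H`, it is `2Δ(G)`. -/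
def distDegeneracy {V : Type*} [Fintype V] (G : SimpleGraph V) (t : ℕ) : ℕ :=
  if ∃ S : Finset V, (G.induce (S : Set V)).HasPairAtDist t then
    (Finset.univ.filter fun S : Finset V => (G.induce (S : Set V)).HasPairAtDist t).sup
      fun S => (G.induce (S : Set V)).minDegreeSumAtDist t
  else 2 * G.maxDegree

end SimpleGraph

end

/-! The polynomial `P_D` is the image of `∏ (X_head - X_tail)`, a polynomial in vertex variables,
under `X_v ↦ ∑_{e ∋ v} x_e`. Before substitution, `∂/∂x_e` with `e = uv` acts as `∂_u + ∂_v`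
(`pderiv_edgeSubst`). If `∂P/∂x_e` has a monomial within given exponent bounds, then `P` has one
within the bounds raised by one at `e`. So it suffices to differentiate down to a nonzero constant,
charging no edge more than `r = ∂₂(G)` times.

This is done by deleting vertices from a set `S`, starting with all of `V`. Operators that kill the
polynomial of the remaining induced subgraph and are constant on the deleted factors leave a scalar
times that polynomial; the scalar must be nonzero.

If `u, v` are at distance two in `G[S]` with degree sum at most `r` and common neighbour `w`, then
`∂_u - ∂_v = (∂_u + ∂_w) - (∂_v + ∂_w)` is charged to `uw` or `vw`. Applying it once per edge
meeting `{u, v}` gives a factorial times a product of nonzero numbers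
(`withinBudget_of_common_adj`). If no pair is at distance two, the components of `G[S]` are
complete, and two adjacent twins are deleted by a mixture of `∂_u - ∂_v` and `∂_u + ∂_v`
(`withinBudget_of_adj_twins`).

A deletion may create a `K₂` component `ab`. It is removed by `∂_a + ∂_y`, where `ay` is an edge to
a deleted vertex that still has one unit of exponent; the set `A` records such reserved edges
(`withinBudget_of_isolated_edge`). After deleting a pair at distance two, a reserve can be missing
only for a pendant edge at `w`. Then another pair is chosen, or the component is a `K_{1,3}` and is
deleted whole (`withinBudget_of_isolated_star`). Niceness excludes `K₂` components at the start.

The list version follows from the Combinatorial Nullstellensatz, as `P_D` is homogeneous. -/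

namespace MvPolynomial

/-! ### Iterated derivations on products of linear forms -/

section Derivation

variable {σ ι K : Type*} [CommRing K] [DecidableEq ι]

/-- The product rule for a derivation that takes constant values on the factors. -/
theorem derivation_mul_prod (D : Derivation K (MvPolynomial σ K) (MvPolynomial σ K))
    {Q : MvPolynomial σ K} (hQ : D Q = 0) (s : Finset ι) {l : ι → MvPolynomial σ K} {a : ι → K}
    (h : ∀ i ∈ s, D (l i) = C (a i)) :
    D (Q * ∏ i ∈ s, l i) = ∑ i ∈ s, (C (a i) * Q) * ∏ j ∈ s.erase i, l j := by
  induction s using Finset.induction_on generalizing Q with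
  | empty => simp [hQ]
  | insert i s hi ih =>
    have hs : ∀ j ∈ s, D (l j) = C (a j) := fun j hj => h j (Finset.mem_insert_of_mem hj)
    have hprod : D (∏ j ∈ s, l j) = ∑ j ∈ s, C (a j) * ∏ k ∈ s.erase j, l k := by
      have := ih (Q := 1) (by simp) hs
      simpa using this
    rw [Finset.prod_insert hi, Finset.sum_insert hi, Finset.erase_insert hi, Derivation.leibniz,
      Derivation.leibniz, hQ, hprod, h i (Finset.mem_insert_self _ _)]
    have : ∀ j ∈ s, (C (a j) * Q) * ∏ k ∈ (insert i s).erase j, l k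
        = Q * l i * (C (a j) * ∏ k ∈ s.erase j, l k) := by
      intro j hj
      have hij : i ≠ j := fun e => hi (e ▸ hj)
      rw [Finset.erase_insert_of_ne hij, Finset.prod_insert (by simp [hi])]
      ring
    rw [Finset.sum_congr rfl this, ← Finset.mul_sum]
    simp only [smul_eq_mul]
    ring

theorem derivation_C_mul_eq (D : Derivation K (MvPolynomial σ K) (MvPolynomial σ K)) (c : K)
    (Q : MvPolynomial σ K) : D (C c * Q) = C c * D Q := by
  rw [← smul_eq_C_mul, ← smul_eq_C_mul, D.map_smul]

/-- Applying a derivation `n` times to a product of `n` factors on which it is constant. -/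
theorem derivation_pow_mul_prod (D : Derivation K (MvPolynomial σ K) (MvPolynomial σ K))
    {l : ι → MvPolynomial σ K} {a : ι → K} {n : ℕ} {s : Finset ι} (hs : s.card = n)
    {Q : MvPolynomial σ K} (hQ : D Q = 0) (h : ∀ i ∈ s, D (l i) = C (a i)) :
    (D.toLinearMap ^ n) (Q * ∏ i ∈ s, l i) = C (n.factorial * ∏ i ∈ s, a i) * Q := by
  induction n generalizing s Q with
  | zero =>
    rw [Finset.card_eq_zero] at hs
    subst hs
    simp
  | succ n ih =>
    -- The constant from the differentiated factor is absorbed into `Q`, so the induction hypothesis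
    -- applies to the remaining `n` factors.
    have key : ∀ i ∈ s, (D.toLinearMap ^ n) ((C (a i) * Q) * ∏ j ∈ s.erase i, l j)
        = C (n.factorial * ∏ i ∈ s, a i) * Q := by
      intro i hi
      rw [ih (by rw [Finset.card_erase_of_mem hi, hs]; rfl)
        (by rw [derivation_C_mul_eq, hQ, mul_zero])
        (fun j hj => h j (Finset.mem_of_mem_erase hj)), ← Finset.mul_prod_erase s a hi]
      simp only [map_mul]
      ring
    rw [pow_succ, Module.End.mul_apply]
    change (D.toLinearMap ^ n) (D _) = _
    rw [derivation_mul_prod D hQ s h, map_sum, Finset.sum_congr rfl key, Finset.sum_const, hs,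
      Nat.factorial_succ, nsmul_eq_mul]
    simp only [map_mul, Nat.cast_mul, map_natCast]
    ring

/-- The mixed version of `derivation_pow_mul_prod`, with two factors removed by a derivation `E`
whose value on each factor is `ρ` times that of `D`. -/
theorem derivation_pow_sq_mul_prod (D E : Derivation K (MvPolynomial σ K) (MvPolynomial σ K))
    {l : ι → MvPolynomial σ K} {a ρ : ι → K} {n : ℕ} {s : Finset ι} (hs : s.card = n + 2)
    {Q : MvPolynomial σ K} (hD : D Q = 0) (hE : E Q = 0) (h : ∀ i ∈ s, D (l i) = C (a i))
    (h' : ∀ i ∈ s, E (l i) = C (ρ i * a i)) :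
    (D.toLinearMap ^ n) (E (E (Q * ∏ i ∈ s, l i)))
      = C (n.factorial * (∏ i ∈ s, a i) * ((∑ i ∈ s, ρ i) ^ 2 - ∑ i ∈ s, ρ i ^ 2)) * Q := by
  -- The two applications of `E` select an ordered pair of distinct factors, of weight `ρ i * ρ j`;
  -- for fixed `i`, the sum over `j ≠ i` gives `ρ i * ∑ ρ - ρ i ^ 2`.
  have step : ∀ i ∈ s, (D.toLinearMap ^ n) (E ((C (ρ i * a i) * Q) * ∏ j ∈ s.erase i, l j))
      = C (n.factorial * (∏ i ∈ s, a i) * (ρ i * ∑ j ∈ s, ρ j - ρ i ^ 2)) * Q := by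
    intro i hi
    rw [derivation_mul_prod E (by rw [derivation_C_mul_eq, hE, mul_zero]) (s.erase i)
      (fun j hj => h' j (Finset.mem_of_mem_erase hj)), map_sum]
    have : ∀ j ∈ s.erase i, (D.toLinearMap ^ n) ((C (ρ j * a j) * (C (ρ i * a i) * Q))
        * ∏ k ∈ (s.erase i).erase j, l k)
        = C (n.factorial * (∏ i ∈ s, a i) * ρ i) * Q * C (ρ j) := by
      intro j hj
      rw [derivation_pow_mul_prod D
        (by rw [Finset.card_erase_of_mem hj, Finset.card_erase_of_mem hi, hs]; rfl)
        (by rw [derivation_C_mul_eq, derivation_C_mul_eq, hD, mul_zero, mul_zero])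
        (fun k hk => h k (Finset.mem_of_mem_erase (Finset.mem_of_mem_erase hk))),
        ← Finset.mul_prod_erase s a hi, ← Finset.mul_prod_erase (s.erase i) a hj]
      simp only [map_mul]
      ring
    rw [Finset.sum_congr rfl this, ← Finset.mul_sum, ← map_sum,
      ← Finset.add_sum_erase s ρ hi]
    simp only [map_mul, map_add, map_sub, map_pow]
    ring
  rw [derivation_mul_prod E hE s h', map_sum, map_sum, Finset.sum_congr rfl step,
    ← Finset.sum_mul, ← map_sum, ← Finset.mul_sum, Finset.sum_sub_distrib, ← Finset.sum_mul,
    sq (∑ i ∈ s, ρ i)]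

end Derivation

/-! ### Monomials with bounded exponents -/

section HasMonomialLE

variable {σ K : Type*} [CommRing K]

/-- Some monomial of `P` has its exponents bounded by `B`. -/
def HasMonomialLE (P : MvPolynomial σ K) (B : σ → ℕ) : Prop :=
  ∃ M ∈ P.support, ∀ e, M e ≤ B e

theorem HasMonomialLE.mono {P : MvPolynomial σ K} {B B' : σ → ℕ} (h : P.HasMonomialLE B)
    (hB : ∀ e, B e ≤ B' e) : P.HasMonomialLE B' := by
  obtain ⟨M, hM, h⟩ := h
  exact ⟨M, hM, fun e => (h e).trans (hB e)⟩

/-- The coefficient of `M` in the derivative is a multiple of the coefficient of `M + single f 1` in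
`P`, so the latter cannot vanish. -/
theorem HasMonomialLE.of_pderiv {P : MvPolynomial σ K} {B B' : σ → ℕ} {f : σ}
    (h : (pderiv f P).HasMonomialLE B) (hf : B f + 1 ≤ B' f) (hB : ∀ e, B e ≤ B' e) :
    P.HasMonomialLE B' := by
  classical
  obtain ⟨M, hM, h⟩ := h
  rw [mem_support_iff, coeff_pderiv] at hM
  refine ⟨M + Finsupp.single f 1, mem_support_iff.2 (left_ne_zero_of_mul hM), fun e => ?_⟩
  have := h e
  have := hB e
  by_cases he : e = f
  · subst he
    simp only [Finsupp.add_apply, Finsupp.single_eq_same]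
    omega
  · simp only [Finsupp.add_apply, Finsupp.single_eq_of_ne he]
    omega

theorem HasMonomialLE.of_sub {P Q : MvPolynomial σ K} {B : σ → ℕ}
    (h : (P - Q).HasMonomialLE B) : P.HasMonomialLE B ∨ Q.HasMonomialLE B := by
  obtain ⟨M, hM, h⟩ := h
  rw [mem_support_iff, coeff_sub] at hM
  by_cases hP : coeff M P = 0
  · refine Or.inr ⟨M, mem_support_iff.2 fun hQ => hM (by rw [hP, hQ, sub_zero]), h⟩
  · exact Or.inl ⟨M, mem_support_iff.2 hP, h⟩

theorem HasMonomialLE.C_mul [IsDomain K] {P : MvPolynomial σ K} {B : σ → ℕ} {c : K} (hc : c ≠ 0)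
    (h : P.HasMonomialLE B) : (C c * P).HasMonomialLE B := by
  obtain ⟨M, hM, h⟩ := h
  refine ⟨M, ?_, h⟩
  rw [mem_support_iff, coeff_C_mul]
  exact mul_ne_zero hc (mem_support_iff.1 hM)

end HasMonomialLE

end MvPolynomial

/-! ### Edge derivatives seen in the vertex variables -/

namespace SimpleGraph

open MvPolynomial

section VertexPolynomial

variable {V : Type*} [Fintype V] (G : SimpleGraph V)

/-- The substitution of `∑_{e ∋ v} x_e` for each vertex variable. -/
noncomputable def edgeSubst : MvPolynomial V ℝ →ₐ[ℝ] MvPolynomial G.edgeSet ℝ :=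
  aeval fun v => G.incidentSum X v

variable {G}

open Classical in
theorem pderiv_incidentSum (e : G.edgeSet) (v : V) :
    pderiv e (G.incidentSum (X : G.edgeSet → MvPolynomial G.edgeSet ℝ) v)
      = if v ∈ (e : Sym2 V) then 1 else 0 := by
  unfold incidentSum
  rw [map_sum]
  simp only [pderiv_X, Pi.single_apply]
  rw [Finset.sum_ite_eq']
  simp

/-- The chain rule: the variable of the edge `uv` occurs, with coefficient one, in the sums at `u`
and `v` only. -/
theorem pderiv_edgeSubst {u v : V} (h : G.Adj u v) (Q : MvPolynomial V ℝ) :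
    pderiv (⟨s(u, v), h⟩ : G.edgeSet) (G.edgeSubst Q)
      = G.edgeSubst ((pderiv u + pderiv v : Derivation ℝ _ _) Q) := by
  classical
  have huv := h.ne
  induction Q using MvPolynomial.induction_on with
  | C a => simp [edgeSubst]
  | add p q hp hq => simp only [map_add, hp, hq]
  | mul_X p i hp =>
    have hX : pderiv (⟨s(u, v), h⟩ : G.edgeSet) (G.edgeSubst (X i))
        = G.edgeSubst ((pderiv u + pderiv v : Derivation ℝ _ _) (X i)) := by
      have : G.edgeSubst (X i) = G.incidentSum X i := by simp [edgeSubst]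
      rw [this, pderiv_incidentSum, Derivation.add_apply, pderiv_X, pderiv_X]
      by_cases h1 : i = u
      · subst h1; simp [huv]
      · by_cases h2 : i = v
        · subst h2; simp [huv.symm]
        · simp [h1, h2]
    rw [map_mul, Derivation.leibniz, Derivation.leibniz, hp, hX]
    simp only [smul_eq_mul, map_add, map_mul]

open Classical in
/-- The indicator function of the edge between `u` and `v`. -/
noncomputable def edgeIndicator (u v : V) (e : G.edgeSet) : ℕ := if (e : Sym2 V) = s(u, v) then 1 else 0

theorem hasMonomialLE_of_adj {u v : V} (h : G.Adj u v) {Q : MvPolynomial V ℝ} {B : G.edgeSet → ℕ}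
    (hQ : (G.edgeSubst ((pderiv u + pderiv v : Derivation ℝ _ _) Q)).HasMonomialLE B) :
    (G.edgeSubst Q).HasMonomialLE (fun e => B e + edgeIndicator u v e) := by
  rw [← pderiv_edgeSubst h] at hQ
  exact hQ.of_pderiv (by simp [edgeIndicator]) (by simp)

/-- The `∂_w` terms cancel in the difference of the derivatives along `uw` and `vw`. A monomial of a
difference survives in one of the two terms; which one is unknown, so both edges are charged. -/
theorem hasMonomialLE_of_common_adj {u v w : V} (hu : G.Adj u w) (hv : G.Adj v w)
    {Q : MvPolynomial V ℝ} {B : G.edgeSet → ℕ}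
    (hQ : (G.edgeSubst ((pderiv u - pderiv v : Derivation ℝ _ _) Q)).HasMonomialLE B) :
    (G.edgeSubst Q).HasMonomialLE
      (fun e => B e + (edgeIndicator u w e + edgeIndicator v w e)) := by
  have : G.edgeSubst ((pderiv u - pderiv v : Derivation ℝ _ _) Q)
      = G.edgeSubst ((pderiv u + pderiv w : Derivation ℝ _ _) Q)
        - G.edgeSubst ((pderiv v + pderiv w : Derivation ℝ _ _) Q) := by
    rw [← map_sub]
    simp [Derivation.add_apply, Derivation.sub_apply]
  rw [this] at hQ
  rcases hQ.of_sub with h | h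
  · exact (hasMonomialLE_of_adj hu h).mono fun e => by omega
  · exact (hasMonomialLE_of_adj hv h).mono fun e => by omega

theorem hasMonomialLE_of_common_adj_pow {u v w : V} (hu : G.Adj u w) (hv : G.Adj v w) (n : ℕ)
    {Q : MvPolynomial V ℝ} {B : G.edgeSet → ℕ}
    (hQ : (G.edgeSubst (((pderiv u - pderiv v : Derivation ℝ _ _).toLinearMap ^ n) Q)).HasMonomialLE
      B) :
    (G.edgeSubst Q).HasMonomialLE
      (fun e => B e + n * (edgeIndicator u w e + edgeIndicator v w e)) := by
  induction n generalizing Q with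
  | zero => simpa using hQ
  | succ n ih =>
    rw [pow_succ, Module.End.mul_apply] at hQ
    exact (hasMonomialLE_of_common_adj hu hv (ih hQ)).mono fun e => by
      rw [add_mul]; omega

/-- Using a different common neighbour each time spreads the charge over many edges. -/
theorem hasMonomialLE_of_common_adj_sum {u v : V} {W : Finset V}
    (hW : ∀ w ∈ W, G.Adj u w ∧ G.Adj v w) {Q : MvPolynomial V ℝ} {B : G.edgeSet → ℕ}
    (hQ : (G.edgeSubst
      (((pderiv u - pderiv v : Derivation ℝ _ _).toLinearMap ^ W.card) Q)).HasMonomialLE B) :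
    (G.edgeSubst Q).HasMonomialLE
      (fun e => B e + ∑ w ∈ W, (edgeIndicator u w e + edgeIndicator v w e)) := by
  classical
  induction W using Finset.induction_on generalizing Q with
  | empty => simpa using hQ
  | insert w W hw ih =>
    rw [Finset.card_insert_of_notMem hw, pow_succ, Module.End.mul_apply] at hQ
    have h1 := ih (fun x hx => hW x (Finset.mem_insert_of_mem hx)) hQ
    obtain ⟨h2, h3⟩ := hW w (Finset.mem_insert_self _ _)
    refine (hasMonomialLE_of_common_adj h2 h3 h1).mono fun e => ?_
    rw [Finset.sum_insert hw]
    omega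

end VertexPolynomial

end SimpleGraph

/-! ### Edges and polynomials of induced subgraphs -/

namespace SimpleGraph

open MvPolynomial

section InducedPolynomial

variable {V : Type*} [Fintype V] {G : SimpleGraph V}

open Classical in
/-- The edges with both ends in `S`. -/
noncomputable def edgesInside (G : SimpleGraph V) (S : Finset V) : Finset G.edgeSet :=
  Finset.univ.filter fun e => ∀ v ∈ (e : Sym2 V), v ∈ S

open Classical in
/-- The edges with both ends in `S` and at least one end in `W`. -/
noncomputable def edgesMeeting (G : SimpleGraph V) (S W : Finset V) : Finset G.edgeSet :=
  (G.edgesInside S).filter fun e : G.edgeSet => ∃ v ∈ W, v ∈ (e : Sym2 V)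

open Classical in
/-- The degree of `u` in the subgraph induced by `S`. -/
noncomputable def degreeInside (G : SimpleGraph V) (S : Finset V) (u : V) : ℕ :=
  (S.filter fun z => G.Adj u z).card

theorem mem_edgesInside {S : Finset V} {e : G.edgeSet} :
    e ∈ G.edgesInside S ↔ ∀ v ∈ (e : Sym2 V), v ∈ S := by
  simp [edgesInside]

theorem mem_edgesMeeting {S W : Finset V} {e : G.edgeSet} :
    e ∈ G.edgesMeeting S W ↔
      (∀ v ∈ (e : Sym2 V), v ∈ S) ∧ ∃ v ∈ W, v ∈ (e : Sym2 V) := by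
  simp [edgesMeeting, mem_edgesInside]

open Classical in
theorem card_edgesMeeting_singleton {S : Finset V} {u : V} (hu : u ∈ S) :
    (G.edgesMeeting S {u}).card = G.degreeInside S u := by
  symm
  refine Finset.card_bij (fun z hz => ⟨s(u, z), (Finset.mem_filter.1 hz).2⟩) ?_ ?_ ?_
  · intro z hz
    simp only [Finset.mem_filter] at hz
    simp [mem_edgesMeeting, hu, hz.1]
  · intro z hz z' hz' h
    exact Sym2.congr_right.1 (congrArg Subtype.val h)
  · rintro ⟨e, he⟩ h
    rw [mem_edgesMeeting] at h
    obtain ⟨h1, x, hx, hxe⟩ := h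
    rw [Finset.mem_singleton] at hx
    subst hx
    obtain ⟨z, rfl⟩ := Sym2.mem_iff_exists.1 hxe
    exact ⟨z, Finset.mem_filter.2 ⟨h1 z (by simp), he⟩, rfl⟩

open Classical in
theorem edgesMeeting_pair (S : Finset V) (u v : V) :
    G.edgesMeeting S {u, v} = G.edgesMeeting S {u} ∪ G.edgesMeeting S {v} := by
  ext e
  simp only [mem_edgesMeeting, Finset.mem_union, Finset.mem_insert, Finset.mem_singleton]
  aesop

open Classical in
theorem card_edgesMeeting_pair_le {S : Finset V} {u v : V} (hu : u ∈ S) (hv : v ∈ S) :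
    (G.edgesMeeting S {u, v}).card ≤ G.degreeInside S u + G.degreeInside S v := by
  rw [edgesMeeting_pair, ← card_edgesMeeting_singleton hu, ← card_edgesMeeting_singleton hv]
  exact Finset.card_union_le _ _

open Classical in
theorem card_edgesMeeting_pair_of_adj {S : Finset V} {u v : V} (hu : u ∈ S) (hv : v ∈ S)
    (h : G.Adj u v) :
    (G.edgesMeeting S {u, v}).card + 1 = G.degreeInside S u + G.degreeInside S v := by
  rw [edgesMeeting_pair, ← card_edgesMeeting_singleton hu, ← card_edgesMeeting_singleton hv,
    ← Finset.card_union_add_card_inter]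
  congr 1
  symm
  rw [Finset.card_eq_one]
  refine ⟨⟨s(u, v), h⟩, ?_⟩
  ext ⟨e, he⟩
  simp only [Finset.mem_inter, mem_edgesMeeting, Finset.mem_singleton, exists_eq_left]
  constructor
  · rintro ⟨⟨-, h1⟩, -, h2⟩
    exact Subtype.ext ((Sym2.mem_and_mem_iff h.ne).1 ⟨h1, h2⟩)
  · intro h'
    obtain rfl : e = s(u, v) := congrArg Subtype.val h'
    simp [hu, hv]

/-! ### Incidence numbers and factorization of the vertex polynomial -/

namespace EdgeOrientation

variable (D : G.EdgeOrientation)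

/-- The linear form of an edge in the vertex variables. -/
noncomputable def vertexForm (e : G.edgeSet) : MvPolynomial V ℝ := X (D.head e) - X (D.tail e)

/-- The product of the linear forms of the edges inside `S`. -/
noncomputable def vertexPolynomial (S : Finset V) : MvPolynomial V ℝ :=
  ∏ e ∈ G.edgesInside S, D.vertexForm e

open Classical in
/-- The incidence number of the vertex `u` and the oriented edge `e`. -/
noncomputable def incidence (u : V) (e : G.edgeSet) : ℝ :=
  (if D.head e = u then 1 else 0) - (if D.tail e = u then 1 else 0)

omit [Fintype V] in
theorem pderiv_vertexForm (u : V) (e : G.edgeSet) :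
    pderiv u (D.vertexForm e) = C (D.incidence u e) := by
  classical
  simp [vertexForm, incidence, pderiv_X, Pi.single_apply, apply_ite C]

omit [Fintype V] in
theorem tail_ne_head (e : G.edgeSet) : D.tail e ≠ D.head e := by
  have h : G.Adj (D.tail e) (D.head e) := by
    rw [← SimpleGraph.mem_edgeSet, D.ends_eq]
    exact e.2
  exact h.ne

omit [Fintype V] in
theorem mem_iff (u : V) (e : G.edgeSet) : u ∈ (e : Sym2 V) ↔ u = D.tail e ∨ u = D.head e := by
  rw [← D.ends_eq e, Sym2.mem_iff]

omit [Fintype V] in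
theorem incidence_eq_zero {u : V} {e : G.edgeSet} (h : u ∉ (e : Sym2 V)) :
    D.incidence u e = 0 := by
  rw [D.mem_iff, not_or] at h
  simp [incidence, Ne.symm h.1, Ne.symm h.2]

omit [Fintype V] in
theorem incidence_eq_or {u : V} {e : G.edgeSet} (h : u ∈ (e : Sym2 V)) :
    D.incidence u e = 1 ∨ D.incidence u e = -1 := by
  have := D.tail_ne_head e
  rw [D.mem_iff] at h
  rcases h with rfl | rfl
  · right; simp [incidence, this.symm]
  · left; simp [incidence, this]

omit [Fintype V] in
theorem incidence_eq_neg {u v : V} {e : G.edgeSet} (huv : u ≠ v) (hu : u ∈ (e : Sym2 V))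
    (hv : v ∈ (e : Sym2 V)) : D.incidence u e = -D.incidence v e := by
  have := D.tail_ne_head e
  rw [D.mem_iff] at hu hv
  rcases hu with rfl | rfl <;> rcases hv with rfl | rfl <;>
    simp_all [incidence, this.symm]

omit [Fintype V] in
-- Incidence numbers at the two ends of an edge are opposite signs, so the difference is `±1` or
-- `±2`. This keeps the scalars in the deletions nonzero.
theorem incidence_sub_ne_zero {u v : V} {e : G.edgeSet} (huv : u ≠ v)
    (h : u ∈ (e : Sym2 V) ∨ v ∈ (e : Sym2 V)) : D.incidence u e - D.incidence v e ≠ 0 := by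
  by_cases hu : u ∈ (e : Sym2 V) <;> by_cases hv : v ∈ (e : Sym2 V)
  · rw [D.incidence_eq_neg huv hu hv]
    rcases D.incidence_eq_or hv with h | h <;> rw [h] <;> norm_num
  · rw [D.incidence_eq_zero hv]
    rcases D.incidence_eq_or hu with h | h <;> rw [h] <;> norm_num
  · rw [D.incidence_eq_zero hu]
    rcases D.incidence_eq_or hv with h | h <;> rw [h] <;> norm_num
  · tauto

omit [Fintype V] in
open Classical in
-- Supplies the ratio `ρ` of `∂_u + ∂_v` to `∂_u - ∂_v` on a factor: `1` at `u` only, `-1` at `v`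
-- only, `0` on the edge `uv`.
theorem incidence_add_eq {u v : V} (e : G.edgeSet) (huv : u ≠ v) :
    D.incidence u e + D.incidence v e
      = ((if u ∈ (e : Sym2 V) then 1 else 0) - (if v ∈ (e : Sym2 V) then 1 else 0))
        * (D.incidence u e - D.incidence v e) := by
  by_cases hu : u ∈ (e : Sym2 V) <;> by_cases hv : v ∈ (e : Sym2 V)
  · rw [D.incidence_eq_neg huv hu hv]; simp [hu, hv]
  · simp [hu, hv, D.incidence_eq_zero hv]
  · simp [hu, hv, D.incidence_eq_zero hu]
  · simp [hu, hv, D.incidence_eq_zero hu, D.incidence_eq_zero hv]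

theorem pderiv_vertexPolynomial_of_notMem {S : Finset V} {u : V} (hu : u ∉ S) :
    pderiv u (D.vertexPolynomial S) = 0 := by
  classical
  have := derivation_mul_prod (pderiv u : Derivation ℝ (MvPolynomial V ℝ) _) (Q := 1) (by simp)
    (G.edgesInside S) (l := D.vertexForm) (fun i _ => D.pderiv_vertexForm u i)
  rw [one_mul] at this
  rw [vertexPolynomial, this]
  refine Finset.sum_eq_zero fun e he => ?_
  rw [D.incidence_eq_zero fun h => hu (mem_edgesInside.1 he u h)]
  simp

open Classical in
theorem vertexPolynomial_eq_mul (S W : Finset V) :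
    D.vertexPolynomial S
      = D.vertexPolynomial (S \ W) * ∏ e ∈ G.edgesMeeting S W, D.vertexForm e := by
  have : G.edgesInside (S \ W)
      = (G.edgesInside S).filter fun e : G.edgeSet => ¬ ∃ v ∈ W, v ∈ (e : Sym2 V) := by
    ext e
    simp only [mem_edgesInside, Finset.mem_filter, Finset.mem_sdiff]
    constructor
    · intro h
      exact ⟨fun v hv => (h v hv).1, fun ⟨v, hv, hve⟩ => (h v hve).2 hv⟩
    · rintro ⟨h1, h2⟩ v hv
      exact ⟨h1 v hv, fun hW => h2 ⟨v, hW, hv⟩⟩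
  rw [vertexPolynomial, vertexPolynomial, this, edgesMeeting, mul_comm,
    Finset.prod_filter_mul_prod_filter_not]

theorem edgeSubst_vertexPolynomial_univ :
    G.edgeSubst (D.vertexPolynomial Finset.univ) = D.colouringPolynomial := by
  classical
  have : G.edgesInside Finset.univ = Finset.univ := by ext; simp [mem_edgesInside]
  simp [vertexPolynomial, colouringPolynomial, this, vertexForm, edgeSubst]

end EdgeOrientation

/-! ### Exponent budgets and reserved edges -/

open Classical in
/-- The exponents allowed for `S`: `r` for the edges inside `S`, `1` for the edges of `A`
with an end in `S`, and `0` for the others. -/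
noncomputable def edgeBudget (G : SimpleGraph V) (r : ℕ) (S : Finset V) (A : Set (Sym2 V))
    (e : G.edgeSet) : ℕ :=
  if e ∈ G.edgesInside S then r else
    if (e : Sym2 V) ∈ A ∧ ∃ v ∈ S, v ∈ (e : Sym2 V) then 1 else 0

theorem edgeBudget_of_mem {r : ℕ} {S : Finset V} {A : Set (Sym2 V)} {e : G.edgeSet}
    (h : e ∈ G.edgesInside S) : G.edgeBudget r S A e = r := by simp [edgeBudget, h]

theorem edgeBudget_eq_zero {r : ℕ} {S : Finset V} {A : Set (Sym2 V)} {e : G.edgeSet}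
    (h : e ∉ G.edgesInside S) (h' : (e : Sym2 V) ∉ A ∨ ∀ v ∈ S, v ∉ (e : Sym2 V)) :
    G.edgeBudget r S A e = 0 := by
  rw [edgeBudget, if_neg h, if_neg]
  rintro ⟨h1, v, h2, h3⟩
  rcases h' with h' | h'
  · exact h' h1
  · exact h' v h2 h3

theorem edgeBudget_le_one {r : ℕ} {S : Finset V} {A : Set (Sym2 V)} {e : G.edgeSet}
    (h : e ∉ G.edgesInside S) : G.edgeBudget r S A e ≤ 1 := by
  rw [edgeBudget, if_neg h]
  split_ifs <;> simp

theorem edgeBudget_le {r : ℕ} (hr : 1 ≤ r) (S : Finset V) (A : Set (Sym2 V)) (e : G.edgeSet) :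
    G.edgeBudget r S A e ≤ r := by
  unfold edgeBudget
  split_ifs <;> omega

/-- If all edges of `A` lie inside `S`, then a budget for a subset of `S` and `A` is within any
budget for `S`. -/
theorem edgeBudget_le_of_subset {r : ℕ} (hr : 1 ≤ r) {S T : Finset V} (hT : T ⊆ S)
    {A A' : Set (Sym2 V)} (hA : ∀ e ∈ A', ∀ v ∈ e, v ∈ S) (e : G.edgeSet) :
    G.edgeBudget r T A' e ≤ G.edgeBudget r S A e := by
  by_cases h : e ∈ G.edgesInside S
  · rw [edgeBudget_of_mem h]
    exact edgeBudget_le hr _ _ _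
  · have h1 : e ∉ G.edgesInside T := fun h' =>
      h (mem_edgesInside.2 fun v hv => hT (mem_edgesInside.1 h' v hv))
    rw [edgeBudget_eq_zero h1 (Or.inl fun h' => h (mem_edgesInside.2 (hA _ h')))]
    exact Nat.zero_le _

theorem edgeBudget_mono {r : ℕ} (hr : 1 ≤ r) {S T : Finset V} (hT : T ⊆ S)
    {A : Set (Sym2 V)} (e : G.edgeSet) :
    G.edgeBudget r T A e ≤ G.edgeBudget r S A e := by
  by_cases h : e ∈ G.edgesInside S
  · rw [edgeBudget_of_mem h]
    exact edgeBudget_le hr _ _ _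
  · have h1 : e ∉ G.edgesInside T := fun h' =>
      h (mem_edgesInside.2 fun v hv => hT (mem_edgesInside.1 h' v hv))
    unfold edgeBudget
    rw [if_neg h, if_neg h1]
    split_ifs with h2 h3
    · exact le_rfl
    · obtain ⟨h4, v, h5, h6⟩ := h2
      exact absurd ⟨h4, v, hT h5, h6⟩ h3
    · exact Nat.zero_le _
    · exact le_rfl

/-- The colouring polynomial of the subgraph induced by `S` has a monomial within the budget. -/
def WithinBudget (D : G.EdgeOrientation) (r : ℕ) (S : Finset V) (A : Set (Sym2 V)) : Prop :=
  (G.edgeSubst (D.vertexPolynomial S)).HasMonomialLE (G.edgeBudget r S A)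

theorem edgeSubst_C_mul (c : ℝ) (Q : MvPolynomial V ℝ) :
    G.edgeSubst (C c * Q) = C c * G.edgeSubst Q := by
  simp [edgeSubst]

end InducedPolynomial

end SimpleGraph

/-! ### The four deletion steps -/

namespace SimpleGraph

open MvPolynomial

section Steps

variable {V : Type*} [Fintype V] {G : SimpleGraph V} (O : G.EdgeOrientation)

omit [Fintype V] in
theorem edgeIndicator_self {u v : V} {e : G.edgeSet} (h : (e : Sym2 V) = s(u, v)) :
    edgeIndicator u v e = 1 := by simp [edgeIndicator, h]

omit [Fintype V] in
theorem edgeIndicator_of_ne {u v : V} {e : G.edgeSet} (h : (e : Sym2 V) ≠ s(u, v)) :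
    edgeIndicator u v e = 0 := by simp [edgeIndicator, h]

open Classical in
/-- Deleting two vertices with a common neighbour. -/
theorem withinBudget_of_common_adj {r : ℕ} (hr : 1 ≤ r) {S : Finset V} {A : Set (Sym2 V)}
    {u v w : V} (hu : u ∈ S) (hv : v ∈ S) (hw : w ∈ S) (huv : u ≠ v) (huw : G.Adj u w)
    (hvw : G.Adj v w) (hcard : (G.edgesMeeting S {u, v}).card ≤ r)
    (h : WithinBudget O r (S \ {u, v})
      {e | (∀ x ∈ e, x ∈ S) ∧ e ≠ s(u, w) ∧ e ≠ s(v, w)}) :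
    WithinBudget O r S A := by
  have key := derivation_pow_mul_prod (pderiv u - pderiv v : Derivation ℝ (MvPolynomial V ℝ) _)
    (l := O.vertexForm) (a := fun e => O.incidence u e - O.incidence v e)
    (s := G.edgesMeeting S {u, v}) rfl (Q := O.vertexPolynomial (S \ {u, v}))
    (by rw [Derivation.sub_apply, O.pderiv_vertexPolynomial_of_notMem (by simp),
      O.pderiv_vertexPolynomial_of_notMem (by simp), sub_zero])
    (fun e _ => by rw [Derivation.sub_apply, O.pderiv_vertexForm, O.pderiv_vertexForm, map_sub])
  rw [← O.vertexPolynomial_eq_mul] at key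
  unfold WithinBudget
  refine (hasMonomialLE_of_common_adj_pow huw hvw
      (G.edgesMeeting S {u, v}).card (B := G.edgeBudget r (S \ {u, v})
      {e | (∀ x ∈ e, x ∈ S) ∧ e ≠ s(u, w) ∧ e ≠ s(v, w)}) ?_).mono ?_
  · rw [key, edgeSubst_C_mul]
    refine HasMonomialLE.C_mul (mul_ne_zero (by positivity) (Finset.prod_ne_zero_iff.2 ?_)) h
    intro e he
    obtain ⟨-, x, hx, hxe⟩ := mem_edgesMeeting.1 he
    refine O.incidence_sub_ne_zero huv ?_
    rw [Finset.mem_insert, Finset.mem_singleton] at hx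
    rcases hx with rfl | rfl <;> tauto
  · intro e
    by_cases h1 : (e : Sym2 V) = s(u, w)
    · have h2 : (e : Sym2 V) ≠ s(v, w) := by rw [h1]; simp [huv, huw.ne]
      rw [edgeIndicator_self h1, edgeIndicator_of_ne h2, edgeBudget_eq_zero _ (Or.inl _),
        edgeBudget_of_mem]
      · simpa using hcard
      · rw [mem_edgesInside, h1]; simp [hu, hw]
      · rw [mem_edgesInside, h1]; simp
      · simp [h1]
    · by_cases h2 : (e : Sym2 V) = s(v, w)
      · rw [edgeIndicator_self h2, edgeIndicator_of_ne h1, edgeBudget_eq_zero _ (Or.inl _),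
          edgeBudget_of_mem]
        · simpa using hcard
        · rw [mem_edgesInside, h2]; simp [hv, hw]
        · rw [mem_edgesInside, h2]; simp
        · simp [h2]
      · rw [edgeIndicator_of_ne h1, edgeIndicator_of_ne h2]
        simpa using edgeBudget_le_of_subset hr Finset.sdiff_subset (fun e he => he.1) e

open Classical in
/-- Deleting an edge which forms a component, using an edge that leaves `S`. -/
theorem withinBudget_of_isolated_edge {r : ℕ} (hr : 1 ≤ r) {S : Finset V} {A : Set (Sym2 V)}
    {a b y : V} (ha : a ∈ S) (hb : b ∈ S) (hy : y ∉ S) (hab : G.Adj a b) (hay : G.Adj a y)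
    (hA : s(a, y) ∈ A) (hiso : ∀ c ∈ S, c ≠ a → c ≠ b → ¬ G.Adj a c ∧ ¬ G.Adj b c)
    (h : WithinBudget O r (S \ {a, b}) A) : WithinBudget O r S A := by
  have hmeet : G.edgesMeeting S {a, b} = {⟨s(a, b), hab⟩} := by
    ext ⟨e, he⟩
    rw [mem_edgesMeeting, Finset.mem_singleton]
    constructor
    · rintro ⟨h1, x, hx, hxe⟩
      refine Subtype.ext ?_
      obtain ⟨z, rfl⟩ := Sym2.mem_iff_exists.1 hxe
      have hz := h1 z (by simp)
      have hxz : G.Adj x z := he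
      rw [Finset.mem_insert, Finset.mem_singleton] at hx
      by_cases hza : z = a
      · subst hza
        rcases hx with rfl | rfl
        · exact absurd rfl hxz.ne
        · exact Sym2.eq_swap
      · by_cases hzb : z = b
        · subst hzb
          rcases hx with rfl | rfl
          · rfl
          · exact absurd rfl hxz.ne
        · rcases hx with rfl | rfl
          · exact absurd hxz (hiso z hz hza hzb).1
          · exact absurd hxz (hiso z hz hza hzb).2
    · intro h'
      obtain rfl : e = s(a, b) := congrArg Subtype.val h'
      simp [ha, hb]
  have hya : y ≠ a := fun h => hy (h ▸ ha)
  have hyb : y ≠ b := fun h => hy (h ▸ hb)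
  have key := derivation_pow_mul_prod (pderiv a + pderiv y : Derivation ℝ (MvPolynomial V ℝ) _)
    (l := O.vertexForm) (a := fun e => O.incidence a e + O.incidence y e)
    (s := G.edgesMeeting S {a, b}) (n := 1) (by rw [hmeet, Finset.card_singleton])
    (Q := O.vertexPolynomial (S \ {a, b}))
    (by rw [Derivation.add_apply, O.pderiv_vertexPolynomial_of_notMem (by simp),
      O.pderiv_vertexPolynomial_of_notMem (by simp [hy]), add_zero])
    (fun e _ => by rw [Derivation.add_apply, O.pderiv_vertexForm, O.pderiv_vertexForm, map_add])
  rw [← O.vertexPolynomial_eq_mul, pow_one] at key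
  unfold WithinBudget
  refine (hasMonomialLE_of_adj hay (B := G.edgeBudget r (S \ {a, b}) A) ?_).mono ?_
  · change (G.edgeSubst ((pderiv a + pderiv y : Derivation ℝ _ _).toLinearMap _)).HasMonomialLE _
    rw [key, edgeSubst_C_mul]
    refine HasMonomialLE.C_mul ?_ h
    -- Only `∂_a` sees the factor of `ab`, so the scalar is `±1`.
    rw [hmeet, Finset.prod_singleton, O.incidence_eq_zero (u := y) (by simp [hya, hyb])]
    rcases O.incidence_eq_or (u := a) (e := ⟨s(a, b), hab⟩) (by simp) with h | h <;>
      rw [h] <;> norm_num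
  · intro e
    by_cases h1 : (e : Sym2 V) = s(a, y)
    -- The reserved unit of `ay` is spent here: this edge has no end in `S \ {a, b}`, so its later
    -- budget is `0` although `A` is unchanged.
    · rw [edgeIndicator_self h1, edgeBudget_eq_zero _ (Or.inr _), edgeBudget, if_neg, if_pos]
      · exact ⟨h1 ▸ hA, a, ha, by simp [h1]⟩
      · rw [mem_edgesInside, h1]; simp [hy]
      · rw [mem_edgesInside, h1]; simp
      · rw [h1]; simp only [Finset.mem_sdiff, Finset.mem_insert, Sym2.mem_iff]
        rintro v ⟨h2, h3⟩ (rfl | rfl)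
        · simp at h3
        · exact hy h2
    · rw [edgeIndicator_of_ne h1]
      exact edgeBudget_mono hr Finset.sdiff_subset e

omit [Fintype V] in
open Classical in
theorem sum_edgeIndicator_le_one {u v : V} (huv : u ≠ v) {W : Finset V} (hu : u ∉ W) (hv : v ∉ W)
    (e : G.edgeSet) :
    ∑ w ∈ W, (edgeIndicator u w e + edgeIndicator v w e) ≤ 1 := by
  have hle : ∀ w ∈ W, edgeIndicator u w e + edgeIndicator v w e ≤ 1 := by
    intro w hw
    by_cases h1 : (e : Sym2 V) = s(u, w)
    · rw [edgeIndicator_self h1, edgeIndicator_of_ne]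
      rw [h1]
      intro h
      rcases Sym2.eq_iff.1 h with ⟨h2, -⟩ | ⟨h2, -⟩
      · exact huv h2
      · exact hu (h2 ▸ hw)
    · rw [edgeIndicator_of_ne h1, edgeIndicator]
      split_ifs <;> simp
  by_cases h : ∃ w ∈ W, (e : Sym2 V) = s(u, w) ∨ (e : Sym2 V) = s(v, w)
  · obtain ⟨w, hw, h⟩ := h
    rw [Finset.sum_eq_single_of_mem w hw]
    · exact hle w hw
    · intro z hz hzw
      have hzu : z ≠ u := fun h => hu (h ▸ hz)
      have hzv : z ≠ v := fun h => hv (h ▸ hz)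
      have : z ∉ (e : Sym2 V) := by rcases h with h | h <;> rw [h] <;> simp [hzw, hzu, hzv]
      rw [edgeIndicator_of_ne (fun h => this (by rw [h]; simp)),
        edgeIndicator_of_ne (fun h => this (by rw [h]; simp)), add_zero]
  · push Not at h
    rw [Finset.sum_eq_zero]
    · simp
    · intro w hw
      simp [edgeIndicator_of_ne (h w hw).1, edgeIndicator_of_ne (h w hw).2]

omit [Fintype V] in
open Classical in
theorem sum_edgeIndicator_eq_zero {u v : V} {W : Finset V} {e : G.edgeSet}
    (h : ∀ w ∈ W, (e : Sym2 V) ≠ s(u, w) ∧ (e : Sym2 V) ≠ s(v, w)) :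
    ∑ w ∈ W, (edgeIndicator u w e + edgeIndicator v w e) = 0 :=
  Finset.sum_eq_zero fun w hw => by
    simp [edgeIndicator_of_ne (h w hw).1, edgeIndicator_of_ne (h w hw).2]

open Classical in
/-- Deleting two adjacent vertices with the same other neighbours. -/
theorem withinBudget_of_adj_twins {r : ℕ} (hr : 2 ≤ r) {S : Finset V} {A : Set (Sym2 V)}
    {u v w : V} (hu : u ∈ S) (hv : v ∈ S) (hw : w ∈ S) (huv : G.Adj u v) (huw : G.Adj u w)
    (hvw : G.Adj v w) (htwin : ∀ z ∈ S, z ≠ u → z ≠ v → (G.Adj u z ↔ G.Adj v z))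
    (h : WithinBudget O r (S \ {u, v}) {s(u, w)}) : WithinBudget O r S A := by
  set U := S.filter fun z => G.Adj u z ∧ G.Adj v z with hU
  have hwU : w ∈ U := by simp [hU, hw, huw, hvw]
  have huU : u ∉ U := by simp [hU]
  have hvU : v ∉ U := by simp [hU]
  have hdu : G.degreeInside S u = U.card + 1 := by
    rw [degreeInside, ← Finset.card_insert_of_notMem hvU]
    congr 1
    ext z
    simp only [Finset.mem_filter, Finset.mem_insert, hU]
    constructor
    · rintro ⟨h1, h2⟩
      by_cases hz : z = v
      · exact Or.inl hz
      · exact Or.inr ⟨h1, h2, (htwin z h1 h2.ne' hz).1 h2⟩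
    · rintro (rfl | h)
      · exact ⟨hv, huv⟩
      · exact ⟨h.1, h.2.1⟩
  have hdv : G.degreeInside S v = U.card + 1 := by
    rw [degreeInside, ← Finset.card_insert_of_notMem huU]
    congr 1
    ext z
    simp only [Finset.mem_filter, Finset.mem_insert, hU]
    constructor
    · rintro ⟨h1, h2⟩
      by_cases hz : z = u
      · exact Or.inl hz
      · exact Or.inr ⟨h1, (htwin z h1 hz h2.ne').2 h2, h2⟩
    · rintro (rfl | h)
      · exact ⟨hu, huv.symm⟩
      · exact ⟨h.1, h.2.2⟩
  have hUpos : 1 ≤ U.card := Finset.card_pos.2 ⟨w, hwU⟩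
  set R := G.edgesMeeting S {u, v} with hR
  -- The `2|U| + 1` factors are removed by two derivatives along `uv` and by `∂_u - ∂_v` applied
  -- through each common neighbour twice, but through `w` only once.
  have hRcard : R.card = ((U.erase w).card + U.card) + 2 := by
    have := card_edgesMeeting_pair_of_adj hu hv huv
    rw [hdu, hdv, ← hR] at this
    rw [Finset.card_erase_of_mem hwU]
    omega
  set ρ : G.edgeSet → ℝ := fun e =>
    (if u ∈ (e : Sym2 V) then 1 else 0) - (if v ∈ (e : Sym2 V) then 1 else 0) with hρ
  have hsub : ∀ x ∈ ({u, v} : Finset V),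
      R.filter (fun e : G.edgeSet => x ∈ (e : Sym2 V)) = G.edgesMeeting S {x} := by
    intro x hx
    ext e
    rw [Finset.mem_filter, hR, mem_edgesMeeting, mem_edgesMeeting]
    constructor
    · rintro ⟨⟨h1, -⟩, h2⟩
      exact ⟨h1, x, by simp, h2⟩
    · rintro ⟨h1, y, hy, h2⟩
      obtain rfl := Finset.mem_singleton.1 hy
      exact ⟨⟨h1, y, hx, h2⟩, h2⟩
  -- Twins have equal degrees, so the scalar reduces to a nonzero multiple of `-∑ ρ ^ 2`, which is
  -- nonzero because of the edge `uw`.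
  have hsum : ∑ e ∈ R, ρ e = 0 := by
    rw [hρ, Finset.sum_sub_distrib, Finset.sum_boole, Finset.sum_boole, hsub u (by simp),
      hsub v (by simp), card_edgesMeeting_singleton hu, card_edgesMeeting_singleton hv, hdu, hdv,
      sub_self]
  have hsq : 0 < ∑ e ∈ R, ρ e ^ 2 := by
    refine Finset.sum_pos' (fun e _ => sq_nonneg _) ⟨⟨s(u, w), huw⟩, ?_, ?_⟩
    · rw [hR, mem_edgesMeeting]
      simp [hu, hw]
    · simp [hρ, huv.ne', hvw.ne]
  have key := derivation_pow_sq_mul_prod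
    (pderiv u - pderiv v : Derivation ℝ (MvPolynomial V ℝ) _)
    (pderiv u + pderiv v : Derivation ℝ (MvPolynomial V ℝ) _)
    (l := O.vertexForm) (a := fun e => O.incidence u e - O.incidence v e) (ρ := ρ)
    hRcard (Q := O.vertexPolynomial (S \ {u, v}))
    (by rw [Derivation.sub_apply, O.pderiv_vertexPolynomial_of_notMem (by simp),
      O.pderiv_vertexPolynomial_of_notMem (by simp), sub_zero])
    (by rw [Derivation.add_apply, O.pderiv_vertexPolynomial_of_notMem (by simp),
      O.pderiv_vertexPolynomial_of_notMem (by simp), add_zero])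
    (fun e _ => by rw [Derivation.sub_apply, O.pderiv_vertexForm, O.pderiv_vertexForm, map_sub])
    (fun e _ => by
      rw [Derivation.add_apply, O.pderiv_vertexForm, O.pderiv_vertexForm, ← map_add,
        O.incidence_add_eq e huv.ne])
  rw [hR, ← O.vertexPolynomial_eq_mul, pow_add, Module.End.mul_apply] at key
  have hUadj : ∀ z ∈ U, G.Adj u z ∧ G.Adj v z := fun z hz => (Finset.mem_filter.1 hz).2
  have base : (G.edgeSubst
      (((pderiv u - pderiv v : Derivation ℝ (MvPolynomial V ℝ) _).toLinearMap ^ (U.erase w).card)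
      (((pderiv u - pderiv v : Derivation ℝ (MvPolynomial V ℝ) _).toLinearMap ^ U.card)
        ((pderiv u + pderiv v : Derivation ℝ (MvPolynomial V ℝ) _)
          ((pderiv u + pderiv v : Derivation ℝ (MvPolynomial V ℝ) _)
            (O.vertexPolynomial S)))))).HasMonomialLE (G.edgeBudget r (S \ {u, v}) {s(u, w)}) := by
    rw [key, ← hR, edgeSubst_C_mul, hsum]
    refine HasMonomialLE.C_mul (mul_ne_zero (mul_ne_zero (by positivity)
      (Finset.prod_ne_zero_iff.2 ?_)) (by rw [zero_pow two_ne_zero, zero_sub]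
                                          exact neg_ne_zero.2 hsq.ne')) h
    intro e he
    obtain ⟨-, x, hx, hxe⟩ := mem_edgesMeeting.1 he
    refine O.incidence_sub_ne_zero huv.ne ?_
    rw [Finset.mem_insert, Finset.mem_singleton] at hx
    rcases hx with rfl | rfl <;> tauto
  unfold WithinBudget
  refine (hasMonomialLE_of_adj huv (hasMonomialLE_of_adj huv
    (hasMonomialLE_of_common_adj_sum hUadj (hasMonomialLE_of_common_adj_sum
      (fun z hz => hUadj z (Finset.mem_of_mem_erase hz)) base)))).mono ?_
  intro e
  have hAS : ∀ e ∈ ({s(u, w)} : Set (Sym2 V)), ∀ x ∈ e, x ∈ S := by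
    rintro e rfl
    simp [hu, hw]
  by_cases hmeet : (∀ x ∈ (e : Sym2 V), x ∈ S) ∧ (u ∈ (e : Sym2 V) ∨ v ∈ (e : Sym2 V))
  · obtain ⟨hS, hmeet⟩ := hmeet
    rw [edgeBudget_of_mem (S := S) (mem_edgesInside.2 hS)]
    have hT : e ∉ G.edgesInside (S \ {u, v}) := by
      rw [mem_edgesInside]
      intro h
      rcases hmeet with h' | h' <;> simpa using h _ h'
    have h1 : ∑ z ∈ U, (edgeIndicator u z e + edgeIndicator v z e) ≤ 1 :=
      sum_edgeIndicator_le_one huv.ne huU hvU e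
    have h2 : ∑ z ∈ U.erase w, (edgeIndicator u z e + edgeIndicator v z e) ≤ 1 :=
      sum_edgeIndicator_le_one huv.ne (fun h => huU (Finset.mem_of_mem_erase h))
        (fun h => hvU (Finset.mem_of_mem_erase h)) e
    by_cases huve : (e : Sym2 V) = s(u, v)
    · have h3 : ∀ z ∈ U, (e : Sym2 V) ≠ s(u, z) ∧ (e : Sym2 V) ≠ s(v, z) := by
        intro z hz
        have hzu : z ≠ u := fun h => huU (h ▸ hz)
        have hzv : z ≠ v := fun h => hvU (h ▸ hz)
        rw [huve]
        simp [hzu.symm, hzv.symm]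
      rw [sum_edgeIndicator_eq_zero h3,
        sum_edgeIndicator_eq_zero fun z hz => h3 z (Finset.mem_of_mem_erase hz),
        edgeIndicator_self huve, edgeBudget_eq_zero hT (Or.inl (by simp [huve, hvw.ne, huw.ne]))]
      omega
    · rw [edgeIndicator_of_ne huve]
      by_cases huwe : (e : Sym2 V) = s(u, w)
      · have h3 : ∀ z ∈ U.erase w, (e : Sym2 V) ≠ s(u, z) ∧ (e : Sym2 V) ≠ s(v, z) := by
          intro z hz
          have hzw : z ≠ w := Finset.ne_of_mem_erase hz
          rw [huwe]
          simp [hzw.symm, huv.ne, hvw.ne', huw.ne']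
        have := edgeBudget_le_one (r := r) (A := {s(u, w)}) hT
        rw [sum_edgeIndicator_eq_zero h3]
        omega
      · rw [edgeBudget_eq_zero hT (Or.inl huwe)]
        omega
  · have h3 : ∀ z ∈ U, (e : Sym2 V) ≠ s(u, z) ∧ (e : Sym2 V) ≠ s(v, z) := by
      intro z hz
      have hzS : z ∈ S := (Finset.mem_filter.1 hz).1
      constructor <;> intro h <;> exact hmeet (by rw [h]; simp [hu, hv, hzS])
    rw [sum_edgeIndicator_eq_zero h3,
      sum_edgeIndicator_eq_zero fun z hz => h3 z (Finset.mem_of_mem_erase hz),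
      edgeIndicator_of_ne (fun h => hmeet (by rw [h]; simp [hu, hv]))]
    simpa using edgeBudget_le_of_subset (by omega) Finset.sdiff_subset hAS e

open Classical in
/-- Deleting a component which is a star with three edges. -/
theorem withinBudget_of_isolated_star {r : ℕ} (hr : 1 ≤ r) {S : Finset V} {A : Set (Sym2 V)}
    {u v b w : V} (hu : u ∈ S) (hv : v ∈ S) (hb : b ∈ S) (hw : w ∈ S) (huv : u ≠ v) (hub : u ≠ b)
    (hvb : v ≠ b) (huw : G.Adj u w) (hvw : G.Adj v w) (hbw : G.Adj b w)
    (hNu : ∀ z ∈ S, G.Adj u z → z = w) (hNv : ∀ z ∈ S, G.Adj v z → z = w)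
    (hNb : ∀ z ∈ S, G.Adj b z → z = w) (hNw : ∀ z ∈ S, G.Adj w z → z = u ∨ z = v ∨ z = b)
    (h : WithinBudget O r (S \ {u, v, b, w}) ∅) : WithinBudget O r S A := by
  set e₁ : G.edgeSet := ⟨s(u, w), huw⟩
  set e₂ : G.edgeSet := ⟨s(v, w), hvw⟩
  set e₃ : G.edgeSet := ⟨s(b, w), hbw⟩
  have h12 : e₁ ≠ e₂ := fun h =>
    huv (Sym2.congr_left.1 (congrArg Subtype.val h))
  have h13 : e₁ ≠ e₃ := fun h =>
    hub (Sym2.congr_left.1 (congrArg Subtype.val h))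
  have h23 : e₂ ≠ e₃ := fun h =>
    hvb (Sym2.congr_left.1 (congrArg Subtype.val h))
  have hmeet : G.edgesMeeting S {u, v, b, w} = {e₁, e₂, e₃} := by
    ext ⟨e, he⟩
    simp only [mem_edgesMeeting, Finset.mem_insert, Finset.mem_singleton]
    constructor
    · rintro ⟨h1, x, hx, hxe⟩
      obtain ⟨z, rfl⟩ := Sym2.mem_iff_exists.1 hxe
      have hz := h1 z (by simp)
      have hxz : G.Adj x z := he
      rcases hx with rfl | rfl | rfl | rfl
      · obtain rfl := hNu z hz hxz
        exact Or.inl rfl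
      · obtain rfl := hNv z hz hxz
        exact Or.inr (Or.inl rfl)
      · obtain rfl := hNb z hz hxz
        exact Or.inr (Or.inr rfl)
      · rcases hNw z hz hxz with rfl | rfl | rfl
        · exact Or.inl (Subtype.ext Sym2.eq_swap)
        · exact Or.inr (Or.inl (Subtype.ext Sym2.eq_swap))
        · exact Or.inr (Or.inr (Subtype.ext Sym2.eq_swap))
    · rintro (h' | h' | h')
      · obtain rfl : e = s(u, w) := congrArg Subtype.val h'
        exact ⟨by simp [hu, hw], w, by simp⟩
      · obtain rfl : e = s(v, w) := congrArg Subtype.val h'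
        exact ⟨by simp [hv, hw], w, by simp⟩
      · obtain rfl : e = s(b, w) := congrArg Subtype.val h'
        exact ⟨by simp [hb, hw], w, by simp⟩
  set Q := O.vertexPolynomial (S \ {u, v, b, w}) with hQ
  have hprod : O.vertexPolynomial S
      = Q * (O.vertexForm e₁ * (O.vertexForm e₂ * O.vertexForm e₃)) := by
    rw [O.vertexPolynomial_eq_mul S {u, v, b, w}, hmeet, Finset.prod_insert (by simp [h12, h13]),
      Finset.prod_insert (by simp [h23]), Finset.prod_singleton]
  have hzero : ∀ x ∈ ({u, v, b, w} : Finset V), pderiv x Q = 0 := fun x hx =>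
    O.pderiv_vertexPolynomial_of_notMem fun h => (Finset.mem_sdiff.1 h).2 hx
  have hleaf : ∀ (x y : V) (hy : G.Adj y w), x ≠ y → x ≠ w →
      O.incidence x ⟨s(y, w), hy⟩ = 0 := fun x y hy h1 h2 =>
    O.incidence_eq_zero (by simp [h1, h2])
  have hown : ∀ (y : V) (hy : G.Adj y w),
      O.incidence y ⟨s(y, w), hy⟩ = -O.incidence w ⟨s(y, w), hy⟩ := fun y hy =>
    O.incidence_eq_neg hy.ne (by simp) (by simp)
  have hunit : ∀ (y : V) (hy : G.Adj y w), O.incidence w ⟨s(y, w), hy⟩ ≠ 0 := fun y hy => by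
    rcases O.incidence_eq_or (u := w) (e := ⟨s(y, w), hy⟩) (by simp) with h | h <;>
      rw [h] <;> norm_num
  -- Differentiating along an edge of the star kills its own factor and gives the incidence number
  -- at `w` on the other two. The factor `2` counts the derangements of three objects.
  have key : (pderiv b + pderiv w : Derivation ℝ (MvPolynomial V ℝ) _)
      ((pderiv v + pderiv w : Derivation ℝ (MvPolynomial V ℝ) _)
        ((pderiv u + pderiv w : Derivation ℝ (MvPolynomial V ℝ) _) (O.vertexPolynomial S)))
      = C (2 * (O.incidence w e₁ * O.incidence w e₂ * O.incidence w e₃)) * Q := by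
    rw [hprod]
    simp only [Derivation.add_apply, Derivation.leibniz, map_add, smul_eq_mul,
      O.pderiv_vertexForm, hzero u (by simp), hzero v (by simp), hzero b (by simp),
      hzero w (by simp), pderiv_C, e₁, e₂, e₃, hown, hleaf u v hvw huv huw.ne,
      hleaf u b hbw hub huw.ne, hleaf v u huw huv.symm hvw.ne, hleaf v b hbw hvb hvw.ne,
      hleaf b u huw hub.symm hbw.ne, hleaf b v hvw hvb.symm hbw.ne, map_neg, map_zero, map_mul,
      map_ofNat]
    ring
  unfold WithinBudget
  refine (hasMonomialLE_of_adj huw (hasMonomialLE_of_adj hvw (hasMonomialLE_of_adj hbw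
    (B := G.edgeBudget r (S \ {u, v, b, w}) ∅) ?_))).mono ?_
  · rw [key, edgeSubst_C_mul]
    exact HasMonomialLE.C_mul (mul_ne_zero two_ne_zero
      (mul_ne_zero (mul_ne_zero (hunit _ _) (hunit _ _)) (hunit _ _))) h
  · intro e
    have hone : edgeIndicator b w e + edgeIndicator v w e + edgeIndicator u w e ≤ 1 := by
      unfold edgeIndicator
      split_ifs with h1 h2 h3 h3 h2 h3 h3 <;> first | omega | skip
      · exact absurd (h1.symm.trans h2) (by simp [hvb.symm, hbw.ne])
      · exact absurd (h1.symm.trans h2) (by simp [hvb.symm, hbw.ne])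
      · exact absurd (h1.symm.trans h3) (by simp [hub.symm, hbw.ne])
      · exact absurd (h2.symm.trans h3) (by simp [huv.symm, hvw.ne])
    by_cases he : w ∈ (e : Sym2 V) ∧ ∀ x ∈ (e : Sym2 V), x ∈ S
    · rw [edgeBudget_eq_zero (S := S \ {u, v, b, w}) _ (Or.inl (by simp)),
        edgeBudget_of_mem (mem_edgesInside.2 he.2)]
      · omega
      · rw [mem_edgesInside]
        intro h
        simpa using h w he.1
    · rw [edgeIndicator_of_ne (fun h => he (by rw [h]; simp [hb, hw])),
        edgeIndicator_of_ne (fun h => he (by rw [h]; simp [hv, hw])),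
        edgeIndicator_of_ne (fun h => he (by rw [h]; simp [hu, hw]))]
      simpa using edgeBudget_le_of_subset hr Finset.sdiff_subset (A' := ∅) (by simp) e

end Steps

end SimpleGraph

/-! ### Induction on the vertex set -/

namespace SimpleGraph

open MvPolynomial

section Induction

variable {V : Type*} [Fintype V] {G : SimpleGraph V}

/-- In the subgraph induced by `S`, the vertices `u` and `v` are at distance `2` and `w` is
a common neighbour. -/
def IsPairAtDistTwo (G : SimpleGraph V) (S : Finset V) (u v w : V) : Prop :=
  u ∈ S ∧ v ∈ S ∧ w ∈ S ∧ u ≠ v ∧ ¬ G.Adj u v ∧ G.Adj u w ∧ G.Adj v w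

/-- The edge `ab` is a component of the subgraph induced by `S`. -/
def IsIsolatedEdge (G : SimpleGraph V) (S : Finset V) (a b : V) : Prop :=
  a ∈ S ∧ b ∈ S ∧ G.Adj a b ∧ ∀ c ∈ S, c ≠ a → c ≠ b → ¬ G.Adj a c ∧ ¬ G.Adj b c

/-- From every isolated edge of the subgraph induced by `S`, an edge of `A` leaves `S`. -/
def IsolatedEdgesServed (G : SimpleGraph V) (S : Finset V) (A : Set (Sym2 V)) : Prop :=
  ∀ a b, G.IsIsolatedEdge S a b →
    ∃ y ∉ S, (G.Adj a y ∧ s(a, y) ∈ A) ∨ (G.Adj b y ∧ s(b, y) ∈ A)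

omit [Fintype V] in
theorem IsIsolatedEdge.symm {S : Finset V} {a b : V} (h : G.IsIsolatedEdge S a b) :
    G.IsIsolatedEdge S b a :=
  ⟨h.2.1, h.1, h.2.2.1.symm, fun c hc h1 h2 => (h.2.2.2 c hc h2 h1).symm⟩

omit [Fintype V] in
open Classical in
-- Removing a whole component creates no new isolated edges, and the vertices outside `S` stay
-- outside.
theorem isolatedEdgesServed_of_isolatedEdge {S : Finset V} {A : Set (Sym2 V)} {a b : V}
    (hab : G.IsIsolatedEdge S a b) (h : G.IsolatedEdgesServed S A) :
    G.IsolatedEdgesServed (S \ {a, b}) A := by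
  intro c d hcd
  obtain ⟨hc, hd, hadj, hiso⟩ := hcd
  simp only [Finset.mem_sdiff, Finset.mem_insert, Finset.mem_singleton, not_or] at hc hd hiso
  have hcd' : G.IsIsolatedEdge S c d := by
    refine ⟨hc.1, hd.1, hadj, fun x hx hxc hxd => ?_⟩
    by_cases hxa : x = a
    · subst hxa
      exact ⟨fun h' => (hab.2.2.2 c hc.1 hc.2.1 hc.2.2).1 h'.symm,
        fun h' => (hab.2.2.2 d hd.1 hd.2.1 hd.2.2).1 h'.symm⟩
    · by_cases hxb : x = b
      · subst hxb
        exact ⟨fun h' => (hab.2.2.2 c hc.1 hc.2.1 hc.2.2).2 h'.symm,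
          fun h' => (hab.2.2.2 d hd.1 hd.2.1 hd.2.2).2 h'.symm⟩
      · exact hiso x ⟨hx, hxa, hxb⟩ hxc hxd
  obtain ⟨y, hy, h'⟩ := h c d hcd'
  exact ⟨y, fun hy' => hy (Finset.mem_sdiff.1 hy').1, h'⟩

omit [Fintype V] in
open Classical in
/-- An isolated edge that arises by deleting `W` is joined to `W`. -/
theorem IsIsolatedEdge.exists_adj {S W : Finset V} (hS : ∀ a b, ¬ G.IsIsolatedEdge S a b)
    {a b : V} (hab : G.IsIsolatedEdge (S \ W) a b) :
    ∃ c ∈ S, c ∈ W ∧ (G.Adj a c ∨ G.Adj b c) := by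
  obtain ⟨ha, hb, hadj, hiso⟩ := hab
  by_contra! hcon
  refine hS a b ⟨(Finset.mem_sdiff.1 ha).1, (Finset.mem_sdiff.1 hb).1, hadj,
    fun c hc hca hcb => ?_⟩
  by_cases hcW : c ∈ W
  · exact hcon c hc hcW
  · exact hiso c (Finset.mem_sdiff.2 ⟨hc, hcW⟩) hca hcb

omit [Fintype V] in
open Classical in
-- A new isolated edge is joined to `u` or `v`. If neither end is `w`, the joining edge is reserved.
-- If one end is `w`, only `uw` and `vw` may be unavailable, so failure forces the other end to be a
-- leaf at `w`.
theorem isolatedEdgesServed_or_exists_leaf {S : Finset V}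
    (hS : ∀ a b, ¬ G.IsIsolatedEdge S a b) {u v w : V} (h : G.IsPairAtDistTwo S u v w) :
    G.IsolatedEdgesServed (S \ {u, v}) {e | (∀ x ∈ e, x ∈ S) ∧ e ≠ s(u, w) ∧ e ≠ s(v, w)} ∨
    ∃ b ∈ S, b ≠ u ∧ b ≠ v ∧ G.Adj b w ∧ (∀ z ∈ S, G.Adj b z → z = w) ∧
      ∀ z ∈ S, G.Adj w z → z = u ∨ z = v ∨ z = b := by
  obtain ⟨hu, hv, hw, huv, hnadj, huw, hvw⟩ := h
  refine or_iff_not_imp_left.2 fun hns => ?_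
  unfold IsolatedEdgesServed at hns
  push Not at hns
  obtain ⟨a, b, hab, hns⟩ := hns
  have hedge : ∀ x ∈ S, x ≠ w → x ≠ u → x ≠ v → ∀ y, y = u ∨ y = v →
      s(x, y) ∈ {e : Sym2 V | (∀ x ∈ e, x ∈ S) ∧ e ≠ s(u, w) ∧ e ≠ s(v, w)} := by
    intro x hx hxw hxu hxv y hy
    refine ⟨?_, ?_, ?_⟩
    · rcases hy with rfl | rfl <;> simp [hx, hu, hv]
    · intro h
      have : x ∈ s(u, w) := h ▸ Sym2.mem_mk_left x y
      simp [hxu, hxw] at this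
    · intro h
      have : x ∈ s(v, w) := h ▸ Sym2.mem_mk_left x y
      simp [hxv, hxw] at this
  have main : ∀ a b, G.IsIsolatedEdge (S \ {u, v}) a b → a = w →
      (∀ y ∉ S \ {u, v}, G.Adj b y → s(b, y) ∉
        {e : Sym2 V | (∀ x ∈ e, x ∈ S) ∧ e ≠ s(u, w) ∧ e ≠ s(v, w)}) →
      ∃ b ∈ S, b ≠ u ∧ b ≠ v ∧ G.Adj b w ∧ (∀ z ∈ S, G.Adj b z → z = w) ∧
      ∀ z ∈ S, G.Adj w z → z = u ∨ z = v ∨ z = b := by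
    rintro a b ⟨ha, hb, hadj, hiso⟩ rfl hb'
    simp only [Finset.mem_sdiff, Finset.mem_insert, Finset.mem_singleton, not_or] at hb hiso
    refine ⟨b, hb.1, hb.2.1, hb.2.2, hadj.symm, ?_, ?_⟩
    · intro z hz hbz
      by_contra hza
      by_cases hzuv : z = u ∨ z = v
      · exact hb' z (by simp only [Finset.mem_sdiff, Finset.mem_insert,
          Finset.mem_singleton]; tauto) hbz
          (hedge b hb.1 hadj.ne' hb.2.1 hb.2.2 z hzuv)
      · rw [not_or] at hzuv
        exact (hiso z ⟨hz, hzuv⟩ hza hbz.ne').2 hbz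
    · intro z hz haz
      by_contra hcon
      push Not at hcon
      exact (hiso z ⟨hz, hcon.1, hcon.2.1⟩ haz.ne' hcon.2.2).1 haz
  have hnot : ∀ y, y = u ∨ y = v → y ∉ S \ {u, v} := by
    intro y hy
    simp only [Finset.mem_sdiff, Finset.mem_insert, Finset.mem_singleton]
    tauto
  obtain ⟨c, -, hcW, hc⟩ := hab.exists_adj hS
  have hcW' : c = u ∨ c = v := by simpa using hcW
  have ha := hab.1
  have hb := hab.2.1
  simp only [Finset.mem_sdiff, Finset.mem_insert, Finset.mem_singleton, not_or] at ha hb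
  by_cases haw : a = w
  · exact main a b hab haw fun y hy hby => (hns y hy).2 hby
  · by_cases hbw : b = w
    · exact main b a hab.symm hbw fun y hy hay => (hns y hy).1 hay
    · rcases hc with hc | hc
      · exact absurd (hedge a ha.1 haw ha.2.1 ha.2.2 c hcW') ((hns c (hnot c hcW')).1 hc)
      · exact absurd (hedge b hb.1 hbw hb.2.1 hb.2.2 c hcW') ((hns c (hnot c hcW')).2 hc)

open Classical in
-- Isolated edges are deleted first. Once none remain, every later isolated edge is caused by the
-- current deletion, so `A` may be replaced by a new reserve of edges inside `S`.
theorem withinBudget_of_isolatedEdgesServed (O : G.EdgeOrientation) {r : ℕ} (hr : 2 ≤ r)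
    (hdist : ∀ S : Finset V, (∃ u v w, G.IsPairAtDistTwo S u v w) →
      ∃ u v w, G.IsPairAtDistTwo S u v w ∧ G.degreeInside S u + G.degreeInside S v ≤ r)
    (S : Finset V) (A : Set (Sym2 V)) (hA : G.IsolatedEdgesServed S A) :
    WithinBudget O r S A := by
  have hr1 : 1 ≤ r := by omega
  induction S using Finset.strongInduction generalizing A with
  | H S ih =>
  have hlt : ∀ (W : Finset V) (x : V), x ∈ W → x ∈ S → S \ W ⊂ S := fun W x hW hS =>
    Finset.ssubset_iff_subset_ne.2 ⟨Finset.sdiff_subset, fun h =>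
      (Finset.mem_sdiff.1 (h.symm ▸ hS : x ∈ S \ W)).2 hW⟩
  by_cases hiso : ∃ a b, G.IsIsolatedEdge S a b
  · obtain ⟨a, b, hab⟩ := hiso
    obtain ⟨y, hy, ⟨h1, h2⟩ | ⟨h1, h2⟩⟩ := hA a b hab
    · exact withinBudget_of_isolated_edge O hr1 hab.1 hab.2.1 hy hab.2.2.1 h1 h2 hab.2.2.2
        (ih _ (hlt _ a (by simp) hab.1) A (isolatedEdgesServed_of_isolatedEdge hab hA))
    · exact withinBudget_of_isolated_edge O hr1 hab.2.1 hab.1 hy hab.2.2.1.symm h1 h2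
        hab.symm.2.2.2
        (ih _ (hlt _ b (by simp) hab.2.1) A (isolatedEdgesServed_of_isolatedEdge hab.symm hA))
  push Not at hiso
  by_cases hpair : ∃ u v w, G.IsPairAtDistTwo S u v w
  · obtain ⟨u, v, w, huvw, hle⟩ := hdist S hpair
    have step : ∀ u v, G.IsPairAtDistTwo S u v w →
        G.degreeInside S u + G.degreeInside S v ≤ r →
        G.IsolatedEdgesServed (S \ {u, v})
          {e | (∀ x ∈ e, x ∈ S) ∧ e ≠ s(u, w) ∧ e ≠ s(v, w)} → WithinBudget O r S A := by
      rintro u v ⟨hu, hv, hw, huv, -, huw, hvw⟩ hle hs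
      exact withinBudget_of_common_adj O hr1 hu hv hw huv huw hvw
        ((card_edgesMeeting_pair_le hu hv).trans hle) (ih _ (hlt _ u (by simp) hu) _ hs)
    rcases isolatedEdgesServed_or_exists_leaf hiso huvw with hs | ⟨b, hb, hbu, hbv, hbw, hNb, hNw⟩
    · exact step u v huvw hle hs
    -- When `v` has a second neighbour, delete `b, u` instead. The leaf `b` has degree at most that
    -- of `v`, and another failure would make `v` a leaf, since it is the only remaining candidate.
    have leaf : ∀ u v, G.IsPairAtDistTwo S u v w →
        G.degreeInside S u + G.degreeInside S v ≤ r → b ≠ u →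
        (∀ z ∈ S, G.Adj w z → z = u ∨ z = v ∨ z = b) →
        ∀ z ∈ S, G.Adj v z → z ≠ w → WithinBudget O r S A := by
      rintro u v ⟨hu, hv, hw, huv, -, huw, hvw⟩ hle hbu hNw z hz hvz hzw
      have hbu' : G.IsPairAtDistTwo S b u w :=
        ⟨hb, hu, hw, hbu, fun h => huw.ne (hNb u hu h), hbw, huw⟩
      have hdeg : G.degreeInside S b ≤ G.degreeInside S v := by
        refine Finset.card_le_card fun x hx => ?_
        rw [Finset.mem_filter] at hx ⊢
        obtain rfl := hNb x hx.1 hx.2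
        exact ⟨hw, hvw⟩
      refine step b u hbu' (by omega) ?_
      rcases isolatedEdgesServed_or_exists_leaf hiso hbu' with
        hs | ⟨c, hc, hcb, hcu, hcw, hNc, -⟩
      · exact hs
      · rcases hNw c hc hcw.symm with rfl | rfl | rfl
        · exact absurd rfl hcu
        · exact absurd (hNc z hz hvz) hzw
        · exact absurd rfl hcb
    by_cases hNv : ∀ z ∈ S, G.Adj v z → z = w
    · by_cases hNu : ∀ z ∈ S, G.Adj u z → z = w
      · obtain ⟨hu, hv, hw, huv, -, huw, hvw⟩ := huvw
        refine withinBudget_of_isolated_star O hr1 hu hv hb hw huv hbu.symm hbv.symm huw hvw hbw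
          hNu hNv hNb hNw (ih _ (hlt _ u (by simp) hu) _ fun a d had => ?_)
        exfalso
        obtain ⟨c, hc, hcW, hadj⟩ := had.exists_adj hiso
        have ha := had.1
        have hd := had.2.1
        simp only [Finset.mem_sdiff, Finset.mem_insert, Finset.mem_singleton, not_or] at ha hd hcW
        rcases hcW with rfl | rfl | rfl | rfl <;> rcases hadj with h | h
        · exact ha.2.2.2.2 (hNu _ ha.1 h.symm)
        · exact hd.2.2.2.2 (hNu _ hd.1 h.symm)
        · exact ha.2.2.2.2 (hNv _ ha.1 h.symm)
        · exact hd.2.2.2.2 (hNv _ hd.1 h.symm)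
        · exact ha.2.2.2.2 (hNb _ ha.1 h.symm)
        · exact hd.2.2.2.2 (hNb _ hd.1 h.symm)
        · have := hNw _ ha.1 h.symm
          tauto
        · have := hNw _ hd.1 h.symm
          tauto
      · push Not at hNu
        obtain ⟨z, hz, h1, h2⟩ := hNu
        obtain ⟨hu, hv, hw, huv, hnadj, huw, hvw⟩ := huvw
        exact leaf v u ⟨hv, hu, hw, huv.symm, fun h => hnadj h.symm, hvw, huw⟩ (by omega) hbv
          (fun z hz h => by have := hNw z hz h; tauto) z hz h1 h2
    · push Not at hNv
      obtain ⟨z, hz, h1, h2⟩ := hNv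
      exact leaf u v huvw hle hbu hNw z hz h1 h2
  -- Without pairs at distance two, components are complete; hence any two adjacent vertices are
  -- twins.
  · have htrans : ∀ x ∈ S, ∀ y ∈ S, ∀ z ∈ S, x ≠ z → G.Adj x y → G.Adj z y → G.Adj x z := by
      intro x hx y hy z hz hxz hxy hzy
      by_contra h
      exact hpair ⟨x, z, y, hx, hz, hy, hxz, h, hxy, hzy⟩
    by_cases hedge : ∃ u ∈ S, ∃ v ∈ S, G.Adj u v
    · obtain ⟨u, hu, v, hv, huv⟩ := hedge
      have htwin : ∀ z ∈ S, z ≠ u → z ≠ v → (G.Adj u z ↔ G.Adj v z) := fun z hz hzu hzv =>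
        ⟨fun h => htrans v hv u hu z hz hzv.symm huv.symm h.symm,
          fun h => htrans u hu v hv z hz hzu.symm huv h.symm⟩
      have hw : ∃ w ∈ S, w ≠ u ∧ w ≠ v ∧ G.Adj u w := by
        by_contra! hcon
        exact hiso u v ⟨hu, hv, huv, fun c hc hcu hcv =>
          ⟨hcon c hc hcu hcv, fun h => hcon c hc hcu hcv ((htwin c hc hcu hcv).2 h)⟩⟩
      obtain ⟨w, hw, hwu, hwv, huw⟩ := hw
      refine withinBudget_of_adj_twins O hr hu hv hw huv huw ((htwin w hw hwu hwv).1 huw) htwin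
        (ih _ (hlt _ u (by simp) hu) _ fun a b hab => ?_)
      obtain ⟨c, hc, hcW, hadj⟩ := hab.exists_adj hiso
      obtain ⟨ha, hb, hab, hab'⟩ := hab
      simp only [Finset.mem_sdiff, Finset.mem_insert, Finset.mem_singleton, not_or] at ha hb hcW hab'
      have hu' : G.Adj u a ∨ G.Adj u b := by
        rcases hcW with rfl | rfl
        · exact hadj.imp (fun h => h.symm) fun h => h.symm
        · exact hadj.imp (fun h => (htwin a ha.1 ha.2.1 ha.2.2).2 h.symm)
            fun h => (htwin b hb.1 hb.2.1 hb.2.2).2 h.symm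
      have hua : G.Adj u a := by
        rcases hu' with h | h
        · exact h
        · exact htrans u hu b hb.1 a ha.1 (Ne.symm ha.2.1) h hab
      -- The new isolated edge is all that remains of the component, so it contains `w` and the
      -- reserved edge `uw` serves it.
      have hwab : w = a ∨ w = b := by
        by_contra hcon
        rw [not_or] at hcon
        exact (hab' w ⟨hw, hwu, hwv⟩ hcon.1 hcon.2).1
          (htrans a ha.1 u hu w hw (Ne.symm hcon.1) hua.symm huw.symm)
      refine ⟨u, by simp, ?_⟩
      rcases hwab with rfl | rfl
      · exact Or.inl ⟨huw.symm, Sym2.eq_swap⟩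
      · exact Or.inr ⟨huw.symm, Sym2.eq_swap⟩
    · have hnone : G.edgesInside S = ∅ := by
        rw [Finset.eq_empty_iff_forall_notMem]
        rintro ⟨e, he⟩ hmem
        rw [mem_edgesInside] at hmem
        induction e using Sym2.ind with
        | _ x y => exact hedge ⟨x, hmem x (by simp), y, hmem y (by simp), he⟩
      refine ⟨0, ?_, by simp⟩
      rw [EdgeOrientation.vertexPolynomial, hnone]
      simp

end Induction

end SimpleGraph

/-! ### The degeneracy bound and list weightings -/

namespace SimpleGraph

open MvPolynomial

section Main

variable {V : Type*} [Fintype V] {G : SimpleGraph V}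

omit [Fintype V] in
theorem edist_induce_eq_two_iff {S : Finset V} {u v : (S : Set V)} :
    (G.induce (S : Set V)).edist u v = (2 : ℕ) ↔ ∃ w, G.IsPairAtDistTwo S u v w := by
  rw [Nat.cast_ofNat, edist_eq_two_iff]
  constructor
  · rintro ⟨h1, h2, w, hw⟩
    rw [mem_commonNeighbors] at hw
    exact ⟨w, u.2, v.2, w.2, fun h => h1 (Subtype.ext h), h2, hw.1, hw.2⟩
  · rintro ⟨w, hu, hv, hw, h1, h2, h3, h4⟩
    exact ⟨fun h => h1 (congrArg _ h), h2, ⟨w, hw⟩, (mem_commonNeighbors ..).2 ⟨h3, h4⟩⟩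

omit [Fintype V] in
theorem hasPairAtDist_induce_iff {S : Finset V} :
    (G.induce (S : Set V)).HasPairAtDist 2 ↔ ∃ u v w, G.IsPairAtDistTwo S u v w := by
  constructor
  · rintro ⟨u, v, h⟩
    exact ⟨u, v, edist_induce_eq_two_iff.1 h⟩
  · rintro ⟨u, v, w, h⟩
    exact ⟨⟨u, h.1⟩, ⟨v, h.2.1⟩, edist_induce_eq_two_iff.2 ⟨w, h⟩⟩

omit [Fintype V] in
open Classical in
theorem degree_induce_eq_degreeInside (S : Finset V) (u : (S : Set V)) :
    (G.induce (S : Set V)).degree u = G.degreeInside S u := by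
  rw [degree, ← Finset.card_map (Function.Embedding.subtype _), degreeInside]
  congr 1
  ext z
  simp only [Finset.mem_map, mem_neighborFinset, Function.Embedding.subtype_apply,
    Finset.mem_filter]
  constructor
  · rintro ⟨x, hx, rfl⟩
    exact ⟨x.2, hx⟩
  · rintro ⟨hz, h⟩
    exact ⟨⟨z, hz⟩, h, rfl⟩

omit [Fintype V] in
theorem exists_degreeInside_add_eq_minDegreeSumAtDist {S : Finset V}
    (h : ∃ u v w, G.IsPairAtDistTwo S u v w) :
    ∃ u v w, G.IsPairAtDistTwo S u v w ∧
      G.degreeInside S u + G.degreeInside S v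
        = (G.induce (S : Set V)).minDegreeSumAtDist 2 := by
  classical
  obtain ⟨u, v, huv⟩ := hasPairAtDist_induce_iff.2 h
  obtain ⟨x, y, hxy, hmin⟩ := Nat.sInf_mem (s := {n : ℕ | ∃ u v,
    (G.induce (S : Set V)).edist u v = (2 : ℕ) ∧
      n = (G.induce (S : Set V)).degree u + (G.induce (S : Set V)).degree v}) ⟨_, u, v, huv, rfl⟩
  obtain ⟨w, hw⟩ := edist_induce_eq_two_iff.1 hxy
  refine ⟨x, y, w, hw, ?_⟩
  rw [degree_induce_eq_degreeInside, degree_induce_eq_degreeInside] at hmin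
  rw [← hmin]
  unfold minDegreeSumAtDist
  congr!

omit [Fintype V] in
theorem degreeInside_pos {S : Finset V} {u w : V} (hw : w ∈ S) (h : G.Adj u w) :
    0 < G.degreeInside S u := by
  classical
  exact Finset.card_pos.2 ⟨w, Finset.mem_filter.2 ⟨hw, h⟩⟩

theorem minDegreeSumAtDist_le_distDegeneracy {S : Finset V}
    (h : ∃ u v w, G.IsPairAtDistTwo S u v w) :
    (G.induce (S : Set V)).minDegreeSumAtDist 2 ≤ G.distDegeneracy 2 := by
  classical
  have h' := hasPairAtDist_induce_iff.2 h
  unfold distDegeneracy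
  rw [if_pos ⟨S, h'⟩]
  exact Finset.le_sup (f := fun S : Finset V => (G.induce (S : Set V)).minDegreeSumAtDist 2)
    (Finset.mem_filter.2 ⟨Finset.mem_univ S, h'⟩)

theorem exists_degreeInside_add_le_distDegeneracy {S : Finset V}
    (h : ∃ u v w, G.IsPairAtDistTwo S u v w) :
    ∃ u v w, G.IsPairAtDistTwo S u v w ∧
      G.degreeInside S u + G.degreeInside S v ≤ G.distDegeneracy 2 := by
  obtain ⟨u, v, w, huvw, hmin⟩ := exists_degreeInside_add_eq_minDegreeSumAtDist h
  exact ⟨u, v, w, huvw, hmin.trans_le (minDegreeSumAtDist_le_distDegeneracy h)⟩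

/-- Two vertices at distance two each have positive degree, and in the default case `2Δ ≥ 2`. The
twin deletion needs exponent two. -/
theorem two_le_distDegeneracy {a b : V} (hab : G.Adj a b) : 2 ≤ G.distDegeneracy 2 := by
  classical
  by_cases h : ∃ S : Finset V, ∃ u v w, G.IsPairAtDistTwo S u v w
  · obtain ⟨S, hS⟩ := h
    obtain ⟨u, v, w, ⟨-, -, hw, -, -, huw, hvw⟩, hle⟩ :=
      exists_degreeInside_add_le_distDegeneracy hS
    have := degreeInside_pos hw huw
    have := degreeInside_pos hw hvw
    omega
  · unfold distDegeneracy
    rw [if_neg fun ⟨S, hS⟩ => h ⟨S, hasPairAtDist_induce_iff.1 hS⟩]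
    have h1 : 0 < G.degree a := (G.degree_pos_iff_exists_adj a).2 ⟨b, hab⟩
    have h2 := G.degree_le_maxDegree a
    omega

theorem IsNice.not_isIsolatedEdge (hG : G.IsNice) (a b : V) :
    ¬ G.IsIsolatedEdge Finset.univ a b := by
  rintro ⟨-, -, hab, hiso⟩
  have hclosed : ∀ x y : V, G.Reachable x y → (x = a ∨ x = b) → (y = a ∨ y = b) := by
    rintro x y ⟨p⟩
    induction p with
    | nil => exact id
    | @cons u v w huv _ ih =>
      intro hu
      refine ih ?_
      by_contra hcon
      rw [not_or] at hcon
      have := hiso v (Finset.mem_univ v) hcon.1 hcon.2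
      rcases hu with rfl | rfl
      · exact this.1 huv
      · exact this.2 huv
  set C := G.connectedComponentMk a with hC
  have hmem : ∀ x, x ∈ C.supp ↔ x = a ∨ x = b := by
    intro x
    rw [ConnectedComponent.mem_supp_iff, hC, ConnectedComponent.eq]
    constructor
    · intro h
      exact hclosed a x h.symm (Or.inl rfl)
    · rintro (rfl | rfl)
      · exact Reachable.refl _
      · exact hab.symm.reachable
  have ha : a ∈ C.supp := (hmem a).2 (Or.inl rfl)
  have hb : b ∈ C.supp := (hmem b).2 (Or.inr rfl)
  have hbij : Function.Bijective (![⟨a, ha⟩, ⟨b, hb⟩] : Fin 2 → C.supp) := by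
    constructor
    · intro i j hij
      fin_cases i <;> fin_cases j <;> simp_all [hab.ne, hab.ne']
    · rintro ⟨x, hx⟩
      rcases (hmem x).1 hx with rfl | rfl
      · exact ⟨0, rfl⟩
      · exact ⟨1, rfl⟩
  refine (hG C).false (RelIso.symm ⟨Equiv.ofBijective _ hbij, ?_⟩)
  intro i j
  fin_cases i <;> fin_cases j <;> simp [hab, hab.symm]

theorem IsNice.hasMonomialLE (hG : G.IsNice) (O : G.EdgeOrientation) :
    O.colouringPolynomial.HasMonomialLE fun _ => G.distDegeneracy 2 := by
  by_cases hedge : ∃ a b, G.Adj a b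
  · obtain ⟨a, b, hab⟩ := hedge
    have hr := two_le_distDegeneracy hab
    rw [← O.edgeSubst_vertexPolynomial_univ]
    refine HasMonomialLE.mono (withinBudget_of_isolatedEdgesServed O hr
      (fun S => exists_degreeInside_add_le_distDegeneracy) Finset.univ ∅
      fun a b hab => absurd hab (hG.not_isIsolatedEdge a b)) ?_
    exact edgeBudget_le (by omega) _ _
  · have : IsEmpty G.edgeSet := by
      refine ⟨fun ⟨e, he⟩ => ?_⟩
      induction e using Sym2.ind with
      | _ x y => exact hedge ⟨x, y, he⟩
    exact ⟨0, by simp [EdgeOrientation.colouringPolynomial], by simp⟩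

theorem _root_.MvPolynomial.HasMonomialLE.monomialIndex_le {σ K : Type*} [CommRing K] {P : MvPolynomial σ K}
    {r : ℕ} (h : P.HasMonomialLE fun _ => r) : P.monomialIndex ≤ r := by
  obtain ⟨M, hM, hle⟩ := h
  exact (iInf₂_le M hM).trans (Nat.cast_le.2 (Finset.sup_le fun e _ => hle e))

theorem isHomogeneous_colouringPolynomial (O : G.EdgeOrientation) :
    ∃ n, O.colouringPolynomial.IsHomogeneous n := by
  classical
  have h : ∀ v, (G.incidentSum (X : G.edgeSet → MvPolynomial G.edgeSet ℝ) v).IsHomogeneous 1 :=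
    fun v => IsHomogeneous.sum _ _ _ fun e _ => isHomogeneous_X ℝ e
  exact ⟨_, IsHomogeneous.prod _ _ _ fun e _ => (h _).sub (h _)⟩

theorem eval_incidentSum (w : G.edgeSet → ℝ) (v : V) :
    eval w (G.incidentSum (X : G.edgeSet → MvPolynomial G.edgeSet ℝ) v) = G.incidentSum w v := by
  simp [incidentSum]

theorem isVertexColouringBySums_of_eval_ne_zero (O : G.EdgeOrientation) {w : G.edgeSet → ℝ}
    (h : eval w O.colouringPolynomial ≠ 0) : G.IsVertexColouringBySums w := by
  classical
  intro u v huv heq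
  rw [EdgeOrientation.colouringPolynomial, map_prod, Finset.prod_ne_zero_iff] at h
  have he := h ⟨s(u, v), huv⟩ (Finset.mem_univ _)
  rw [map_sub, eval_incidentSum, eval_incidentSum, sub_ne_zero] at he
  rcases Sym2.eq_iff.1 (O.ends_eq ⟨s(u, v), huv⟩) with ⟨h1, h2⟩ | ⟨h1, h2⟩
  · rw [h1, h2] at he
    exact he heq.symm
  · rw [h1, h2] at he
    exact he heq

/-- By homogeneity the given monomial has top degree, as the Combinatorial Nullstellensatz requires;
lists of size `r + 1` exceed all its exponents. -/
theorem edgeWeightChoosable_of_hasMonomialLE (O : G.EdgeOrientation) {r : ℕ}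
    (h : O.colouringPolynomial.HasMonomialLE fun _ => r) : G.EdgeWeightChoosable (r + 1) := by
  intro L hL
  obtain ⟨M, hM, hle⟩ := h
  rw [mem_support_iff] at hM
  obtain ⟨n, hn⟩ := isHomogeneous_colouringPolynomial O
  have hdeg : O.colouringPolynomial.totalDegree = M.degree := by
    rw [hn.totalDegree (fun h0 => hM (by rw [h0, coeff_zero]))]
    by_contra hne
    exact hM (hn.coeff_eq_zero (Ne.symm hne))
  obtain ⟨w, hw, hev⟩ := combinatorial_nullstellensatz_exists_eval_nonzero _ M hM hdeg L
    fun e => by rw [hL]; exact Nat.lt_succ_of_le (hle e)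
  exact ⟨w, hw, isVertexColouringBySums_of_eval_ne_zero O hev⟩

end Main

end SimpleGraph

theorem theorem4p1 {V : Type*} [Fintype V] (G : SimpleGraph V) (hG : G.IsNice)
    (hV : 3 ≤ Fintype.card V) :
    G.monomialIndex ≤ (G.distDegeneracy 2 : ℕ∞) ∧
      G.edgeWeightChoosabilityNumber ≤ (G.distDegeneracy 2 : ℕ∞) + 1 := by
  have h := hG.hasMonomialLE (Classical.arbitrary G.EdgeOrientation)
  refine ⟨h.monomialIndex_le, ?_⟩
  exact (iInf₂_le _ (SimpleGraph.edgeWeightChoosable_of_hasMonomialLE _ h)).trans (by simp)
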